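/- Setting. For $t=1,2,\dots$ let $y(t)=\phi(t)^T\theta_0+v(t)$ with $\theta_0\in\mathbb R^n$, where the noise variables $v(t)$ are i.i.d. $\mathcal N(0,\sigma^2)$, $\sigma>0$, and the (possibly random) regressor sequence $(\phi(t))_t$ in $\mathbb R^n$ is independent of the noise sequence. Let $\Phi=\Phi_N\in\mathbb R^{N\times n}$ have rows $\phi(1)^T,\dots,\phi(N)^T$, let $V=(v(1),\dots,v(N))^T$ and $Y=\Phi\theta_0+V$. Let $\Omega\subset\mathbb R^p$ be open, let $P(\eta)\in\mathbb R^{n\times n}$ be positive definite for every $\eta\in\Omega$ and twice continuously differentiable in $\eta\in\Omega$. Put $Q=\Phi P\Phi^T+\sigma^2I_N$, $\hat\theta(\eta)=P\Phi^TQ^{-1}Y$, $$\mathcal F_N(\eta)=\|Y-\Phi\hat\theta(\eta)\|_2^2+2\sigma^2\operatorname{Tr}(\Phi P\Phi^TQ^{-1}),$$ and, for a positive definite $\Sigma\in\mathbb R^{n\times n}$, $$W_y(\eta)=\sigma^4\theta_0^TP^{-T}\Sigma^{-1}P^{-1}\theta_0-2\sigma^4\operatorname{Tr}(\Sigma^{-1}P^{-1}).$$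 For $\eta\in\Omega$ let $C_y(\eta),D_y(\eta)\in\mathbb R^{p\times p}$ have the entries $$C_y(\eta)_{k,l}=2\sigma^4\Big\{\theta_0^T\tfrac{\partial P^{-1}}{\partial\eta_l}\Sigma^{-1}\tfrac{\partial P^{-1}}{\partial\eta_k}\theta_0+\theta_0^TP^{-1}\Sigma^{-1}\tfrac{\partial^2P^{-1}}{\partial\eta_k\partial\eta_l}\theta_0-\operatorname{Tr}\Big(\Sigma^{-1}\tfrac{\partial^2P^{-1}}{\partial\eta_k\partial\eta_l}\Big)\Big\},$$ $$D_y(\eta)_{k,l}=4\sigma^{10}\,\theta_0^T\Big[P^{-1}\Sigma^{-1}\tfrac{\partial P^{-1}}{\partial\eta_k}+\tfrac{\partial P^{-1}}{\partial\eta_k}\Sigma^{-1}P^{-1}\Big]\Sigma^{-1}\Big[P^{-1}\Sigma^{-1}\tfrac{\partial P^{-1}}{\partial\eta_l}+\tfrac{\partial P^{-1}}{\partial\eta_l}\Sigma^{-1}P^{-1}\Big]\theta_0 .$$ Assumptions. (i) $\Phi^T\Phi/N\to\Sigma$ almost surely, and $\|\Phi^T\Phi/N-\Sigma\|_F=O_p(\delta_N)$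 with $\delta_N=o(1/\sqrt N)$; here $\xi_N=O_p(a_N)$ means that for every $\varepsilon>0$ there is $L>0$ with $\mathbb P(|\xi_N|>L|a_N|)<\varepsilon$ for all $N\ge1$. (ii) $K\subset\Omega$ is compact, and $\eta^*_y$ is the only minimizer of $W_y$ over $\Omega$ that lies in $K$. (iii) $\hat\eta_{\mathrm{Sy}}=\hat\eta_{\mathrm{Sy},N}$ is a sequence of random vectors such that, with probability tending to $1$ as $N\to\infty$, $\hat\eta_{\mathrm{Sy},N}$ is a minimizer of $\mathcal F_N$ over $\Omega$ and lies in $K$. (iv) $C_y(\eta^*_y)$ is invertible. Conclusion. $C_y(\eta^*_y)$ is the Hessian of $W_y$ at $\eta^*_y$, the matrix $C_y(\eta_y^*)^{-1}D_y(\eta_y^*)C_y(\eta_y^*)^{-1}$ is symmetric positive semidefinite, and as $N\to\infty$ $$\sqrt N\,(\hat\eta_{\mathrm{Sy},N}-\eta_y^*)\ \xrightarrow{d}\ \mathcal N\big(0,\;C_y(\eta_y^*)^{-1}D_y(\eta_y^*)C_y(\eta_y^*)^{-1}\big).$$ -/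

import Mathlib

open MeasureTheory ProbabilityTheory Filter Topology Matrix Asymptotics

noncomputable section

/-- The `N × n` regressor matrix `Φ` whose rows are the first `N` regressors. -/
def regMatrix {n : ℕ} (φ : ℕ → Fin n → ℝ) (N : ℕ) : Matrix (Fin N) (Fin n) ℝ :=
  Matrix.of fun t i => φ t i

/-- The output vector `Y = Φ θ₀ + V` of length `N`. -/
def outputVec {n : ℕ} (θ₀ : Fin n → ℝ) (φ : ℕ → Fin n → ℝ) (v : ℕ → ℝ) (N : ℕ) : Fin N → ℝ :=
  regMatrix φ N *ᵥ θ₀ + fun t : Fin N => v t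

/-- `Q = Φ P Φᵀ + σ² I`. -/
def qMatrix {n N : ℕ} (σ : ℝ) (Φ : Matrix (Fin N) (Fin n) ℝ) (P : Matrix (Fin n) (Fin n) ℝ) :
    Matrix (Fin N) (Fin N) ℝ :=
  Φ * P * Φᵀ + σ ^ 2 • (1 : Matrix (Fin N) (Fin N) ℝ)

/-- The regularized least squares estimator `P Φᵀ Q⁻¹ Y`. -/
def rlsEstimator {n N : ℕ} (σ : ℝ) (Φ : Matrix (Fin N) (Fin n) ℝ) (Y : Fin N → ℝ)
    (P : Matrix (Fin n) (Fin n) ℝ) : Fin n → ℝ :=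
  (P * Φᵀ * (qMatrix σ Φ P)⁻¹) *ᵥ Y

/-- The `SURE_y` cost `‖Y - Φ θ̂‖₂² + 2 σ² Tr (Φ P Φᵀ Q⁻¹)`, where `θ̂` is the regularized least
squares estimator with kernel matrix `P`. -/
def sureCost {n N : ℕ} (σ : ℝ) (Φ : Matrix (Fin N) (Fin n) ℝ) (Y : Fin N → ℝ)
    (P : Matrix (Fin n) (Fin n) ℝ) : ℝ :=
  ∑ t, (Y t - (Φ *ᵥ rlsEstimator σ Φ Y P) t) ^ 2
    + 2 * σ ^ 2 * (Φ * P * Φᵀ * (qMatrix σ Φ P)⁻¹).trace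

/-- The limit cost `W_y = σ⁴ θ₀ᵀ P⁻ᵀ Σ⁻¹ P⁻¹ θ₀ - 2 σ⁴ Tr (Σ⁻¹ P⁻¹)`. -/
def limitCost {n : ℕ} (σ : ℝ) (S : Matrix (Fin n) (Fin n) ℝ) (θ₀ : Fin n → ℝ)
    (P : Matrix (Fin n) (Fin n) ℝ) : ℝ :=
  σ ^ 4 * (θ₀ ⬝ᵥ ((P⁻¹)ᵀ * S⁻¹ * P⁻¹) *ᵥ θ₀) - 2 * σ ^ 4 * (S⁻¹ * P⁻¹).trace

/-- The set of minimizers over `A` of a real function `f`. -/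
def argminOn {E : Type*} (f : E → ℝ) (A : Set E) : Set E :=
  {x | x ∈ A ∧ ∀ y ∈ A, f x ≤ f y}

/-- The partial derivative `∂f/∂η_k`. -/
def partialDeriv {p : ℕ} (k : Fin p) (f : EuclideanSpace ℝ (Fin p) → ℝ)
    (η : EuclideanSpace ℝ (Fin p)) : ℝ :=
  fderiv ℝ f η (EuclideanSpace.single k 1)

/-- The matrix `∂P⁻¹/∂η_k`, entry by entry. -/
def dInv {n p : ℕ} (P : EuclideanSpace ℝ (Fin p) → Matrix (Fin n) (Fin n) ℝ) (k : Fin p)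
    (η : EuclideanSpace ℝ (Fin p)) : Matrix (Fin n) (Fin n) ℝ :=
  Matrix.of fun i j => partialDeriv k (fun ξ => (P ξ)⁻¹ i j) η

/-- The matrix `∂²P⁻¹/∂η_k∂η_l`, entry by entry. -/
def ddInv {n p : ℕ} (P : EuclideanSpace ℝ (Fin p) → Matrix (Fin n) (Fin n) ℝ) (k l : Fin p)
    (η : EuclideanSpace ℝ (Fin p)) : Matrix (Fin n) (Fin n) ℝ :=
  Matrix.of fun i j => partialDeriv k (partialDeriv l fun ξ => (P ξ)⁻¹ i j) η

/-- The matrix `C_y(η)`. -/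
def cMatrix {n p : ℕ} (σ : ℝ) (S : Matrix (Fin n) (Fin n) ℝ) (θ₀ : Fin n → ℝ)
    (P : EuclideanSpace ℝ (Fin p) → Matrix (Fin n) (Fin n) ℝ)
    (η : EuclideanSpace ℝ (Fin p)) : Matrix (Fin p) (Fin p) ℝ :=
  Matrix.of fun k l =>
    2 * σ ^ 4 *
      (θ₀ ⬝ᵥ (dInv P l η * S⁻¹ * dInv P k η) *ᵥ θ₀
        + θ₀ ⬝ᵥ ((P η)⁻¹ * S⁻¹ * ddInv P k l η) *ᵥ θ₀
        - (S⁻¹ * ddInv P k l η).trace)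

/-- The matrix `D_y(η)`. -/
def dMatrix {n p : ℕ} (σ : ℝ) (S : Matrix (Fin n) (Fin n) ℝ) (θ₀ : Fin n → ℝ)
    (P : EuclideanSpace ℝ (Fin p) → Matrix (Fin n) (Fin n) ℝ)
    (η : EuclideanSpace ℝ (Fin p)) : Matrix (Fin p) (Fin p) ℝ :=
  Matrix.of fun k l =>
    4 * σ ^ 10 *
      (θ₀ ⬝ᵥ (((P η)⁻¹ * S⁻¹ * dInv P k η + dInv P k η * S⁻¹ * (P η)⁻¹) * S⁻¹ *
        ((P η)⁻¹ * S⁻¹ * dInv P l η + dInv P l η * S⁻¹ * (P η)⁻¹)) *ᵥ θ₀)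

/-- The Frobenius norm. -/
def frobNorm {m n : ℕ} (A : Matrix (Fin m) (Fin n) ℝ) : ℝ :=
  Real.sqrt (∑ i, ∑ j, A i j ^ 2)

/-- `X_N = O_p(a_N)`, boundedness in probability. The inequality `|X_N / a_N| > L` is written
without the division; the sample size `N` runs through the positive integers. -/
def BoundedInProb {α : Type*} [MeasurableSpace α] (μ : Measure α) (X : ℕ → α → ℝ) (a : ℕ → ℝ) :
    Prop :=
  ∀ ε : ℝ, 0 < ε → ∃ L : ℝ, 0 < L ∧
    ∀ N : ℕ, 1 ≤ N → μ {ω | L * |a N| < |X N ω|} < ENNReal.ofReal ε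

end

/-!
In the `SURE_y` cost the kernel matrix `P` meets the data only through the statistics
`z = ΦᵀV / N`, `R = ΦᵀΦ / N` and `e = σ² / N`: by the push-through identity
`P Φᵀ Q⁻¹ = (ΦᵀΦ + σ² P⁻¹)⁻¹ Φᵀ` the cost equals, up to the
factor `1 / N` and a term free of `P`, the function
`σ⁴ (M B u)ᵀ R (M B u) - 2 σ⁴ Tr (M B)` with `B = P⁻¹`, `M = (R + e B)⁻¹`, `u = θ₀ + R⁻¹ z`
(`sureCost_eq_reducedCost`). This reduced cost is `C²` jointly in the hyper-parameter and in
`(z, R, e)` near `(ηstar, (0, Σ, 0))`, and at `(0, Σ, 0)` it is the limit cost `W_y`. Asymptotic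
normality is therefore a delta method for a minimizer under a perturbed cost:

* a tube-lemma argument forces minimizers in `K` to be close to `ηstar` once `(z, R, e)` is close to
  its limit (`eventually_mem_nhds_of_le`);
* the gradient vanishes at the minimizer and is differentiable at the base point with invertible
  Hessian block `C_y`, so the minimizer is, to first order, a linear function of the deviation of
  `(z, R, e)` (`eventually_norm_le_of_hasFDerivAt`, `eventually_minimizer_expansion`);
* `√N (R - Σ)` and `√N e` vanish in probability, so that only `√N z` matters. Conditionally on the
  regressors it is Gaussian with covariance `σ² R`, hence its characteristic function converges to
  that of `N(0, σ² Σ)` (`tendsto_charFun_sqrt_smul_noiseCorr`). Lévy's theorem and the tightness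
  that comes with it conclude.

The mixed derivative in `η` and `z` is `2 σ⁴ θ₀ᵀ ∂(P⁻¹ Σ⁻¹ P⁻¹)/∂η_l Σ⁻¹`, which turns the
covariance `σ² Σ` into the sandwich `C_y⁻¹ D_y C_y⁻¹` (`sandwich_eq`).
-/

/-! ### The reduced cost -/

/-- The reduced `SURE_y` cost as a function of the inverse kernel matrix `B = P⁻¹`, the empirical
regressor covariance `R = ΦᵀΦ / N`, the noise correlation `z = ΦᵀV / N` and `e = σ² / N`. -/
noncomputable def reducedCost {n : ℕ} (σ : ℝ) (θ₀ : Fin n → ℝ) (B R : Matrix (Fin n) (Fin n) ℝ)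
    (z : Fin n → ℝ) (e : ℝ) : ℝ :=
  σ ^ 4 * ((((R + e • B)⁻¹ * B) *ᵥ (θ₀ + R⁻¹ *ᵥ z)) ⬝ᵥ
      R *ᵥ (((R + e • B)⁻¹ * B) *ᵥ (θ₀ + R⁻¹ *ᵥ z)))
    - 2 * σ ^ 4 * ((R + e • B)⁻¹ * B).trace

lemma isUnit_det_of_posDef {ι : Type*} [Fintype ι] [DecidableEq ι] {A : Matrix ι ι ℝ}
    (hA : A.PosDef) : IsUnit A.det := hA.det_pos.ne'.isUnit

lemma posDef_qMatrix {n N : ℕ} {σ : ℝ} (hσ : 0 < σ) (Φ : Matrix (Fin N) (Fin n) ℝ)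
    {P : Matrix (Fin n) (Fin n) ℝ} (hP : P.PosDef) : (qMatrix σ Φ P).PosDef := by
  have h1 : (Φ * P * Φᵀ).PosSemidef := by
    simpa using hP.posSemidef.mul_mul_conjTranspose_same Φ
  have h2 : (σ ^ 2 • (1 : Matrix (Fin N) (Fin N) ℝ)).PosDef :=
    Matrix.PosDef.one.smul (by positivity)
  exact Matrix.PosDef.posSemidef_add h1 h2

/-- The push-through identity `P Φᵀ Q⁻¹ = (ΦᵀΦ + σ² P⁻¹)⁻¹ Φᵀ`. -/
lemma mul_transpose_mul_qMatrix_inv {n N : ℕ} {σ : ℝ} (hσ : 0 < σ) (Φ : Matrix (Fin N) (Fin n) ℝ)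
    {P : Matrix (Fin n) (Fin n) ℝ} (hP : P.PosDef)
    (hK : IsUnit (Φᵀ * Φ + σ ^ 2 • P⁻¹).det) :
    P * Φᵀ * (qMatrix σ Φ P)⁻¹ = (Φᵀ * Φ + σ ^ 2 • P⁻¹)⁻¹ * Φᵀ := by
  have hQ := isUnit_det_of_posDef (posDef_qMatrix hσ Φ hP)
  have hPu := isUnit_det_of_posDef hP
  have h : (Φᵀ * Φ + σ ^ 2 • P⁻¹) * (P * Φᵀ) = Φᵀ * qMatrix σ Φ P := by
    rw [qMatrix, Matrix.add_mul, Matrix.mul_add, Matrix.smul_mul, ← Matrix.mul_assoc P⁻¹,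
      Matrix.nonsing_inv_mul _ hPu]
    simp [Matrix.mul_assoc]
  calc P * Φᵀ * (qMatrix σ Φ P)⁻¹
      = (Φᵀ * Φ + σ ^ 2 • P⁻¹)⁻¹ * ((Φᵀ * Φ + σ ^ 2 • P⁻¹) * (P * Φᵀ)) * (qMatrix σ Φ P)⁻¹ := by
        rw [Matrix.nonsing_inv_mul_cancel_left _ _ hK]
    _ = _ := by
        rw [h, Matrix.mul_assoc, Matrix.mul_nonsing_inv_cancel_right _ _ hQ]

lemma sum_sq_eq_dotProduct {m : ℕ} (x : Fin m → ℝ) : ∑ t, x t ^ 2 = x ⬝ᵥ x := by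
  simp [dotProduct, sq]

/-- The `SURE_y` cost, split into the least-squares residual and the contribution of the
regularization. -/
lemma sureCost_eq_residual_add {n N : ℕ} {σ : ℝ} (hσ : 0 < σ) (Φ : Matrix (Fin N) (Fin n) ℝ)
    (Y : Fin N → ℝ) {P : Matrix (Fin n) (Fin n) ℝ} (hP : P.PosDef)
    {th : Fin n → ℝ} (hth : (Φᵀ * Φ) *ᵥ th = Φᵀ *ᵥ Y)
    (hK : IsUnit (Φᵀ * Φ + σ ^ 2 • P⁻¹).det) :
    sureCost σ Φ Y P = (Y - Φ *ᵥ th) ⬝ᵥ (Y - Φ *ᵥ th) + 2 * σ ^ 2 * n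
      + σ ^ 4 * ((((Φᵀ * Φ + σ ^ 2 • P⁻¹)⁻¹ * P⁻¹) *ᵥ th) ⬝ᵥ
          (Φᵀ * Φ) *ᵥ (((Φᵀ * Φ + σ ^ 2 • P⁻¹)⁻¹ * P⁻¹) *ᵥ th))
      - 2 * σ ^ 4 * ((Φᵀ * Φ + σ ^ 2 • P⁻¹)⁻¹ * P⁻¹).trace := by
  have hpt := mul_transpose_mul_qMatrix_inv hσ Φ hP hK
  set K := (Φᵀ * Φ + σ ^ 2 • P⁻¹)⁻¹ with hKdef
  have hKH : K * (Φᵀ * Φ) = 1 - σ ^ 2 • (K * P⁻¹) := by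
    have : K * (Φᵀ * Φ + σ ^ 2 • P⁻¹) = 1 := Matrix.nonsing_inv_mul _ hK
    rw [Matrix.mul_add, Matrix.mul_smul] at this
    exact eq_sub_of_add_eq this
  have hest : rlsEstimator σ Φ Y P = th - σ ^ 2 • ((K * P⁻¹) *ᵥ th) := by
    rw [rlsEstimator, hpt, ← Matrix.mulVec_mulVec, ← hth, Matrix.mulVec_mulVec, hKH,
      Matrix.sub_mulVec, Matrix.one_mulVec, Matrix.smul_mulVec]
  have htr : (Φ * P * Φᵀ * (qMatrix σ Φ P)⁻¹).trace = n - σ ^ 2 * (K * P⁻¹).trace := by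
    rw [Matrix.mul_assoc Φ, Matrix.mul_assoc Φ, hpt, Matrix.trace_mul_comm, Matrix.mul_assoc, hKH]
    simp [Matrix.trace_sub, Matrix.trace_smul]
  set w := (K * P⁻¹) *ᵥ th
  have hres : Y - Φ *ᵥ rlsEstimator σ Φ Y P = (Y - Φ *ᵥ th) + σ ^ 2 • (Φ *ᵥ w) := by
    rw [hest, Matrix.mulVec_sub, Matrix.mulVec_smul]; abel
  -- the normal equations make the least-squares residual orthogonal to the range of `Φ`
  have horth : (Y - Φ *ᵥ th) ⬝ᵥ Φ *ᵥ w = 0 := by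
    rw [Matrix.dotProduct_mulVec, ← Matrix.mulVec_transpose, Matrix.mulVec_sub,
      Matrix.mulVec_mulVec, hth, sub_self, zero_dotProduct]
  have hquad : Φ *ᵥ w ⬝ᵥ Φ *ᵥ w = w ⬝ᵥ (Φᵀ * Φ) *ᵥ w := by
    rw [← Matrix.mulVec_mulVec, Matrix.dotProduct_mulVec w, ← Matrix.mulVec_transpose,
      Matrix.transpose_transpose]
  have hsum : ∑ t, (Y t - (Φ *ᵥ rlsEstimator σ Φ Y P) t) ^ 2
      = (Y - Φ *ᵥ th) ⬝ᵥ (Y - Φ *ᵥ th) + σ ^ 4 * (w ⬝ᵥ (Φᵀ * Φ) *ᵥ w) := by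
    have := sum_sq_eq_dotProduct (Y - Φ *ᵥ rlsEstimator σ Φ Y P)
    simp only [Pi.sub_apply] at this
    rw [this, hres, add_dotProduct, dotProduct_add, dotProduct_add, smul_dotProduct,
      dotProduct_smul, smul_dotProduct, dotProduct_smul, dotProduct_comm (Φ *ᵥ w), horth, hquad]
    simp only [smul_eq_mul]; ring
  rw [sureCost, hsum, htr]; ring

/-- Up to a positive factor and a term that does not depend on `P`, the `SURE_y` cost is the
reduced cost. -/
lemma sureCost_eq_reducedCost {n N : ℕ} (hN : 0 < N) {σ : ℝ} (hσ : 0 < σ)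
    (Φ : Matrix (Fin N) (Fin n) ℝ) (θ₀ : Fin n → ℝ) (V : Fin N → ℝ)
    (hR : IsUnit ((N : ℝ)⁻¹ • (Φᵀ * Φ)).det) :
    ∃ c : ℝ, ∀ P : Matrix (Fin n) (Fin n) ℝ, P.PosDef →
      sureCost σ Φ (Φ *ᵥ θ₀ + V) P = c + (N : ℝ)⁻¹ *
        reducedCost σ θ₀ P⁻¹ ((N : ℝ)⁻¹ • (Φᵀ * Φ)) ((N : ℝ)⁻¹ • (Φᵀ *ᵥ V)) (σ ^ 2 / N) := by
  have hN' : (N : ℝ) ≠ 0 := by positivity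
  set R := (N : ℝ)⁻¹ • (Φᵀ * Φ) with hRdef
  set th := θ₀ + R⁻¹ *ᵥ ((N : ℝ)⁻¹ • (Φᵀ *ᵥ V)) with hthdef
  have hH : Φᵀ * Φ = (N : ℝ) • R := by rw [hRdef, smul_smul, mul_inv_cancel₀ hN', one_smul]
  have hth : (Φᵀ * Φ) *ᵥ th = Φᵀ *ᵥ (Φ *ᵥ θ₀ + V) := by
    have h1 : (Φᵀ * Φ) * R⁻¹ = (N : ℝ) • (1 : Matrix (Fin n) (Fin n) ℝ) := by
      rw [hH, Matrix.smul_mul, Matrix.mul_nonsing_inv _ hR]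
    rw [hthdef, Matrix.mulVec_add, Matrix.mulVec_add, Matrix.mulVec_mulVec, Matrix.mulVec_mulVec,
      h1, Matrix.smul_mulVec, Matrix.one_mulVec, smul_smul, mul_inv_cancel₀ hN', one_smul]
  have hRpos : R.PosDef := by
    have h1 : R.PosSemidef := by
      have : (Φᵀ * Φ).PosSemidef := by simpa using Matrix.posSemidef_conjTranspose_mul_self Φ
      exact this.smul (by positivity)
    exact h1.posDef_iff_isUnit.mpr ((Matrix.isUnit_iff_isUnit_det R).mpr hR)
  refine ⟨(Φ *ᵥ θ₀ + V - Φ *ᵥ th) ⬝ᵥ (Φ *ᵥ θ₀ + V - Φ *ᵥ th) + 2 * σ ^ 2 * n, fun P hP => ?_⟩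
  have hM : IsUnit (R + (σ ^ 2 / N) • P⁻¹).det :=
    isUnit_det_of_posDef (hRpos.add (hP.inv.smul (by positivity)))
  have hKM : Φᵀ * Φ + σ ^ 2 • P⁻¹ = (N : ℝ) • (R + (σ ^ 2 / N) • P⁻¹) := by
    rw [smul_add, ← hH, smul_smul, mul_div_cancel₀ _ hN']
  have hKdet : IsUnit (Φᵀ * Φ + σ ^ 2 • P⁻¹).det := by
    rw [hKM, Matrix.det_smul]
    exact (hN'.isUnit.pow _).mul hM
  have hinv : (Φᵀ * Φ + σ ^ 2 • P⁻¹)⁻¹ = (N : ℝ)⁻¹ • (R + (σ ^ 2 / N) • P⁻¹)⁻¹ := by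
    rw [hKM]
    refine Matrix.inv_eq_right_inv ?_
    rw [Matrix.smul_mul, Matrix.mul_smul, Matrix.mul_nonsing_inv _ hM, smul_smul,
      mul_inv_cancel₀ hN', one_smul]
  rw [sureCost_eq_residual_add hσ Φ _ hP hth hKdet, hinv, reducedCost, ← hthdef, hH]
  simp only [Matrix.smul_mul, Matrix.smul_mulVec, Matrix.mulVec_smul, smul_dotProduct,
    dotProduct_smul, Matrix.trace_smul, smul_eq_mul]
  field_simp
  ring

/-! ### Smoothness -/

section EntrySmooth

variable {E : Type*} [NormedAddCommGroup E] [NormedSpace ℝ E] {k : WithTop ℕ∞} {x : E}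
  {l m n : Type*}

/-- A matrix-valued map is `C^k` at a point if each of its entries is; this avoids the choice of a
norm on matrices. -/
def EntryContDiffAt (k : WithTop ℕ∞) (A : E → Matrix l n ℝ) (x : E) : Prop :=
  ∀ i j, ContDiffAt ℝ k (fun y => A y i j) x

lemma EntryContDiffAt.mul [Fintype m] {A : E → Matrix l m ℝ} {B : E → Matrix m n ℝ}
    (hA : EntryContDiffAt k A x) (hB : EntryContDiffAt k B x) :
    EntryContDiffAt k (fun y => A y * B y) x := fun i j => by
  simp only [Matrix.mul_apply]
  exact ContDiffAt.sum fun r _ => (hA i r).mul (hB r j)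

lemma EntryContDiffAt.add_smul {A B : E → Matrix l n ℝ} {e : E → ℝ}
    (hA : EntryContDiffAt k A x) (he : ContDiffAt ℝ k e x) (hB : EntryContDiffAt k B x) :
    EntryContDiffAt k (fun y => A y + e y • B y) x := fun i j => by
  simp only [Matrix.add_apply, Matrix.smul_apply, smul_eq_mul]
  exact (hA i j).add (he.mul (hB i j))

lemma EntryContDiffAt.mulVec [Fintype n] {A : E → Matrix l n ℝ} {u : E → n → ℝ}
    (hA : EntryContDiffAt k A x) (hu : ∀ j, ContDiffAt ℝ k (fun y => u y j) x) (i : l) :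
    ContDiffAt ℝ k (fun y => (A y *ᵥ u y) i) x := by
  simp only [Matrix.mulVec, dotProduct]
  exact ContDiffAt.sum fun r _ => (hA i r).mul (hu r)

lemma EntryContDiffAt.trace [Fintype n] {A : E → Matrix n n ℝ} (hA : EntryContDiffAt k A x) :
    ContDiffAt ℝ k (fun y => (A y).trace) x := by
  simp only [Matrix.trace, Matrix.diag]
  exact ContDiffAt.sum fun r _ => hA r r

lemma EntryContDiffAt.det [Fintype n] [DecidableEq n] {A : E → Matrix n n ℝ}
    (hA : EntryContDiffAt k A x) :
    ContDiffAt ℝ k (fun y => (A y).det) x := by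
  simp only [Matrix.det_apply']
  exact ContDiffAt.sum fun s _ => contDiffAt_const.mul (contDiffAt_prod fun i _ => hA (s i) i)

lemma EntryContDiffAt.inv [Fintype n] [DecidableEq n] {A : E → Matrix n n ℝ}
    (hA : EntryContDiffAt k A x) (h : (A x).det ≠ 0) : EntryContDiffAt k (fun y => (A y)⁻¹) x := by
  intro i j
  simp only [Matrix.inv_def, Matrix.smul_apply, Ring.inverse_eq_inv', smul_eq_mul,
    Matrix.adjugate_apply]
  refine (hA.det.inv h).mul (EntryContDiffAt.det fun a b => ?_)
  by_cases ha : a = j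
  · subst ha; simp only [Matrix.updateRow_self]; exact contDiffAt_const
  · simp only [Matrix.updateRow_ne ha]; exact hA a b

lemma contDiffAt_dotProduct [Fintype n] {u w : E → n → ℝ}
    (hu : ∀ j, ContDiffAt ℝ k (fun y => u y j) x)
    (hw : ∀ j, ContDiffAt ℝ k (fun y => w y j) x) :
    ContDiffAt ℝ k (fun y => u y ⬝ᵥ w y) x := by
  simp only [dotProduct]
  exact ContDiffAt.sum fun r _ => (hu r).mul (hw r)

end EntrySmooth

/-- The space of the statistics `(z, R, e)` through which the data enter the reduced cost. -/
abbrev Stat (n : ℕ) : Type := EuclideanSpace ℝ (Fin n) × (Fin n → Fin n → ℝ) × ℝ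

/-- The reduced cost as a function of the hyper-parameter and of the statistics `(z, R, e)`. -/
noncomputable def reducedCostAt {n p : ℕ} (σ : ℝ) (θ₀ : Fin n → ℝ)
    (P : EuclideanSpace ℝ (Fin p) → Matrix (Fin n) (Fin n) ℝ)
    (ξ : EuclideanSpace ℝ (Fin p) × Stat n) : ℝ :=
  reducedCost σ θ₀ (P ξ.1)⁻¹ (Matrix.of ξ.2.2.1) (WithLp.ofLp ξ.2.1) ξ.2.2.2

lemma contDiffAt_reducedCostAt {n p : ℕ} {σ : ℝ} {θ₀ : Fin n → ℝ}
    {P : EuclideanSpace ℝ (Fin p) → Matrix (Fin n) (Fin n) ℝ}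
    {ξ : EuclideanSpace ℝ (Fin p) × Stat n} {k : WithTop ℕ∞}
    (hP : EntryContDiffAt k (fun η => (P η)⁻¹) ξ.1)
    (hR : (Matrix.of ξ.2.2.1).det ≠ 0)
    (hM : (Matrix.of ξ.2.2.1 + ξ.2.2.2 • (P ξ.1)⁻¹).det ≠ 0) :
    ContDiffAt ℝ k (reducedCostAt σ θ₀ P) ξ := by
  have hB : EntryContDiffAt k (fun ξ : EuclideanSpace ℝ (Fin p) × Stat n => (P ξ.1)⁻¹) ξ :=
    fun i j => (hP i j).comp ξ contDiffAt_fst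
  have hRs : EntryContDiffAt k
      (fun ξ : EuclideanSpace ℝ (Fin p) × Stat n => Matrix.of ξ.2.2.1) ξ := fun i j => by
    simp only [Matrix.of_apply]; fun_prop
  have he : ContDiffAt ℝ k (fun ξ : EuclideanSpace ℝ (Fin p) × Stat n => ξ.2.2.2) ξ := by fun_prop
  have hMB := ((hRs.add_smul he hB).inv hM).mul hB
  have hu : ∀ j, ContDiffAt ℝ k (fun ξ : EuclideanSpace ℝ (Fin p) × Stat n =>
      (θ₀ + (Matrix.of ξ.2.2.1)⁻¹ *ᵥ WithLp.ofLp ξ.2.1) j) ξ := fun j => by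
    simp only [Pi.add_apply]
    refine contDiffAt_const.add ((hRs.inv hR).mulVec (fun i => ?_) j)
    fun_prop
  have hw := hMB.mulVec hu
  exact (contDiffAt_const.mul (contDiffAt_dotProduct hw (hRs.mulVec hw))).sub
    (contDiffAt_const.mul hMB.trace)

/-! ### Derivatives of the limit cost -/

section EntryDeriv

variable {l m n : Type*}

/-- A curve of matrices has the derivative `A'` at `t`, entry by entry. -/
def HasEntryDerivAt (A : ℝ → Matrix l n ℝ) (A' : Matrix l n ℝ) (t : ℝ) : Prop :=
  ∀ i j, HasDerivAt (fun s => A s i j) (A' i j) t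

lemma HasEntryDerivAt.mul [Fintype m] {A : ℝ → Matrix l m ℝ} {B : ℝ → Matrix m n ℝ}
    {A' : Matrix l m ℝ} {B' : Matrix m n ℝ} {t : ℝ}
    (hA : HasEntryDerivAt A A' t) (hB : HasEntryDerivAt B B' t) :
    HasEntryDerivAt (fun s => A s * B s) (A' * B t + A t * B') t := fun i j => by
  simp only [Matrix.mul_apply, Matrix.add_apply, ← Finset.sum_add_distrib]
  exact HasDerivAt.fun_sum fun r _ => (hA i r).mul (hB r j)

lemma HasEntryDerivAt.add {A B : ℝ → Matrix l n ℝ} {A' B' : Matrix l n ℝ} {t : ℝ}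
    (hA : HasEntryDerivAt A A' t) (hB : HasEntryDerivAt B B' t) :
    HasEntryDerivAt (fun s => A s + B s) (A' + B') t := fun i j => (hA i j).add (hB i j)

lemma HasEntryDerivAt.mul_const [Fintype m] {A : ℝ → Matrix l m ℝ} {A' : Matrix l m ℝ} {t : ℝ}
    (hA : HasEntryDerivAt A A' t) (C : Matrix m n ℝ) :
    HasEntryDerivAt (fun s => A s * C) (A' * C) t := by
  have h := hA.mul (B := fun _ => C) (B' := 0) fun i j => hasDerivAt_const t (C i j)
  simpa using h

lemma HasEntryDerivAt.const_mul [Fintype m] {B : ℝ → Matrix m n ℝ} {B' : Matrix m n ℝ} {t : ℝ}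
    (C : Matrix l m ℝ) (hB : HasEntryDerivAt B B' t) :
    HasEntryDerivAt (fun s => C * B s) (C * B') t := by
  have h := HasEntryDerivAt.mul (A := fun _ => C) (A' := 0)
    (fun i j => hasDerivAt_const t (C i j)) hB
  simpa using h

lemma HasEntryDerivAt.quadForm [Fintype n] {A : ℝ → Matrix n n ℝ} {A' : Matrix n n ℝ} {t : ℝ}
    (hA : HasEntryDerivAt A A' t) (u : n → ℝ) :
    HasDerivAt (fun s => u ⬝ᵥ A s *ᵥ u) (u ⬝ᵥ A' *ᵥ u) t := by
  simp only [dotProduct, Matrix.mulVec]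
  exact HasDerivAt.fun_sum fun i _ => (HasDerivAt.fun_sum fun j _ =>
    (hA i j).mul_const _).const_mul _

lemma HasEntryDerivAt.trace [Fintype n] {A : ℝ → Matrix n n ℝ} {A' : Matrix n n ℝ} {t : ℝ}
    (hA : HasEntryDerivAt A A' t) : HasDerivAt (fun s => (A s).trace) A'.trace t := by
  simp only [Matrix.trace, Matrix.diag]
  exact HasDerivAt.fun_sum fun i _ => hA i i

end EntryDeriv

lemma quadForm_transpose {n : Type*} [Fintype n] (A : Matrix n n ℝ) (u : n → ℝ) :
    u ⬝ᵥ Aᵀ *ᵥ u = u ⬝ᵥ A *ᵥ u := by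
  rw [Matrix.mulVec_transpose, dotProduct_comm, ← Matrix.dotProduct_mulVec]

section LimitCost

variable {n p : ℕ}

lemma hasDerivAt_partialDeriv {f : EuclideanSpace ℝ (Fin p) → ℝ} {η : EuclideanSpace ℝ (Fin p)}
    (hf : DifferentiableAt ℝ f η) (k : Fin p) :
    HasDerivAt (fun t : ℝ => f (η + t • EuclideanSpace.single k 1)) (partialDeriv k f η) 0 :=
  hf.hasFDerivAt.hasLineDerivAt _

lemma partialDeriv_eq_of_hasDerivAt {f : EuclideanSpace ℝ (Fin p) → ℝ}
    {η : EuclideanSpace ℝ (Fin p)} (hf : DifferentiableAt ℝ f η) {k : Fin p} {d : ℝ}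
    (h : HasDerivAt (fun t : ℝ => f (η + t • EuclideanSpace.single k 1)) d 0) :
    partialDeriv k f η = d :=
  (hasDerivAt_partialDeriv hf k).unique h

lemma partialDeriv_congr {f g : EuclideanSpace ℝ (Fin p) → ℝ} {η : EuclideanSpace ℝ (Fin p)}
    (h : f =ᶠ[𝓝 η] g) (k : Fin p) : partialDeriv k f η = partialDeriv k g η := by
  rw [partialDeriv, partialDeriv, h.fderiv_eq]

lemma hasEntryDerivAt_dInv {P : EuclideanSpace ℝ (Fin p) → Matrix (Fin n) (Fin n) ℝ}
    {η : EuclideanSpace ℝ (Fin p)} (hB : EntryContDiffAt 1 (fun η => (P η)⁻¹) η) (k : Fin p) :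
    HasEntryDerivAt (fun t : ℝ => (P (η + t • EuclideanSpace.single k 1))⁻¹) (dInv P k η) 0 :=
  fun i j => hasDerivAt_partialDeriv ((hB i j).differentiableAt one_ne_zero) k

lemma contDiffAt_partialDeriv {f : EuclideanSpace ℝ (Fin p) → ℝ} {η : EuclideanSpace ℝ (Fin p)}
    (hf : ContDiffAt ℝ 2 f η) (k : Fin p) : ContDiffAt ℝ 1 (partialDeriv k f) η :=
  (hf.fderiv_right (m := 1) (by norm_num)).clm_apply contDiffAt_const

lemma hasEntryDerivAt_ddInv {P : EuclideanSpace ℝ (Fin p) → Matrix (Fin n) (Fin n) ℝ}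
    {η : EuclideanSpace ℝ (Fin p)} (hB : EntryContDiffAt 2 (fun η => (P η)⁻¹) η) (k l : Fin p) :
    HasEntryDerivAt (fun t : ℝ => dInv P l (η + t • EuclideanSpace.single k 1))
      (ddInv P k l η) 0 :=
  fun i j => hasDerivAt_partialDeriv
    ((contDiffAt_partialDeriv (hB i j) l).differentiableAt one_ne_zero) k

/-- The derivative of `P⁻¹ Σ⁻¹ P⁻¹` in the direction `η_l`. -/
noncomputable def dInvSq (S : Matrix (Fin n) (Fin n) ℝ)
    (P : EuclideanSpace ℝ (Fin p) → Matrix (Fin n) (Fin n) ℝ) (l : Fin p)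
    (η : EuclideanSpace ℝ (Fin p)) : Matrix (Fin n) (Fin n) ℝ :=
  (P η)⁻¹ * S⁻¹ * dInv P l η + dInv P l η * S⁻¹ * (P η)⁻¹

variable {σ : ℝ} {S : Matrix (Fin n) (Fin n) ℝ}
  {P : EuclideanSpace ℝ (Fin p) → Matrix (Fin n) (Fin n) ℝ} {η : EuclideanSpace ℝ (Fin p)}

lemma contDiffAt_limitCost (u : Fin n → ℝ) {k : WithTop ℕ∞}
    (hB : EntryContDiffAt k (fun η => (P η)⁻¹) η) :
    ContDiffAt ℝ k (fun η => limitCost σ S u (P η)) η := by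
  have hS : EntryContDiffAt k (fun _ : EuclideanSpace ℝ (Fin p) => S⁻¹) η :=
    fun i j => contDiffAt_const
  have hBt : EntryContDiffAt k (fun η => ((P η)⁻¹)ᵀ) η := fun i j => hB j i
  have hu : ∀ j, ContDiffAt ℝ k (fun _ : EuclideanSpace ℝ (Fin p) => u j) η :=
    fun j => contDiffAt_const
  exact (contDiffAt_const.mul (contDiffAt_dotProduct hu (((hBt.mul hS).mul hB).mulVec hu))).sub
    (contDiffAt_const.mul (hS.mul hB).trace)

lemma transpose_dInv (hsymm : ∀ᶠ ξ in 𝓝 η, ((P ξ)⁻¹)ᵀ = (P ξ)⁻¹) (l : Fin p) :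
    (dInv P l η)ᵀ = dInv P l η := by
  ext i j
  exact partialDeriv_congr (hsymm.mono fun ξ h => by
    simpa using congrFun (congrFun h i) j) l

lemma transpose_ddInv (hsymm : ∀ᶠ ξ in 𝓝 η, ((P ξ)⁻¹)ᵀ = (P ξ)⁻¹) (k l : Fin p) :
    (ddInv P k l η)ᵀ = ddInv P k l η := by
  ext i j
  exact partialDeriv_congr (hsymm.eventually_nhds.mono fun ξ h => by
    simpa [dInv] using congrFun (congrFun (transpose_dInv h l) i) j) k

lemma partialDeriv_limitCost (u : Fin n → ℝ)
    (hB : EntryContDiffAt 1 (fun η => (P η)⁻¹) η)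
    (hsymm : ∀ᶠ ξ in 𝓝 η, ((P ξ)⁻¹)ᵀ = (P ξ)⁻¹) (l : Fin p) :
    partialDeriv l (fun η => limitCost σ S u (P η)) η =
      σ ^ 4 * (u ⬝ᵥ dInvSq S P l η *ᵥ u) - 2 * σ ^ 4 * (S⁻¹ * dInv P l η).trace := by
  refine partialDeriv_eq_of_hasDerivAt
    ((contDiffAt_limitCost u hB).differentiableAt one_ne_zero) ?_
  have h := hasEntryDerivAt_dInv hB l
  have ht : HasEntryDerivAt (fun t : ℝ => ((P (η + t • EuclideanSpace.single l 1))⁻¹)ᵀ)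
      (dInv P l η)ᵀ 0 := fun i j => h j i
  have hq := (((ht.mul_const S⁻¹).mul h).quadForm u).const_mul (σ ^ 4)
  have htr := ((HasEntryDerivAt.const_mul S⁻¹ h).trace).const_mul (2 * σ ^ 4)
  refine (hq.sub htr).congr_deriv ?_
  simp only [zero_smul, add_zero]
  rw [transpose_dInv hsymm, hsymm.self_of_nhds, dInvSq, add_comm]

lemma transpose_dInvSq (hS : (S⁻¹)ᵀ = S⁻¹) (hsymm : ∀ᶠ ξ in 𝓝 η, ((P ξ)⁻¹)ᵀ = (P ξ)⁻¹)
    (l : Fin p) : (dInvSq S P l η)ᵀ = dInvSq S P l η := by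
  simp only [dInvSq, Matrix.transpose_add, Matrix.transpose_mul, hS, transpose_dInv hsymm,
    hsymm.self_of_nhds, Matrix.mul_assoc]
  rw [add_comm]

/-- `C_y` is the Hessian of the limit cost. -/
lemma cMatrix_eq_partialDeriv (u : Fin n → ℝ) (hS : (S⁻¹)ᵀ = S⁻¹)
    (hB : EntryContDiffAt 2 (fun η => (P η)⁻¹) η)
    (hsymm : ∀ᶠ ξ in 𝓝 η, ((P ξ)⁻¹)ᵀ = (P ξ)⁻¹) (k l : Fin p) :
    cMatrix σ S u P η k l =
      partialDeriv k (partialDeriv l fun η => limitCost σ S u (P η)) η := by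
  have hB1 : ∀ᶠ ξ in 𝓝 η, EntryContDiffAt 1 (fun η => (P η)⁻¹) ξ := by
    refine Filter.eventually_all.2 fun i => Filter.eventually_all.2 fun j => ?_
    exact ((hB i j).of_le one_le_two).eventually (by simp)
  have hev : (partialDeriv l fun η => limitCost σ S u (P η)) =ᶠ[𝓝 η] fun η =>
      σ ^ 4 * (u ⬝ᵥ dInvSq S P l η *ᵥ u) - 2 * σ ^ 4 * (S⁻¹ * dInv P l η).trace := by
    filter_upwards [hB1, hsymm.eventually_nhds] with ξ h1 h2
    exact partialDeriv_limitCost u h1 h2 l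
  have hdiff := (contDiffAt_partialDeriv (contDiffAt_limitCost (σ := σ) (S := S) u hB)
    l).differentiableAt one_ne_zero
  rw [partialDeriv_congr hev]
  refine (partialDeriv_eq_of_hasDerivAt (hdiff.congr_of_eventuallyEq hev.symm) ?_).symm
  have h := hasEntryDerivAt_dInv (hB1.self_of_nhds) k
  have hd := hasEntryDerivAt_ddInv hB k l
  have hq := ((((h.mul_const S⁻¹).mul hd).add ((hd.mul_const S⁻¹).mul h)).quadForm u).const_mul
    (σ ^ 4)
  have htr := ((HasEntryDerivAt.const_mul S⁻¹ hd).trace).const_mul (2 * σ ^ 4)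
  refine (hq.sub htr).congr_deriv ?_
  have e1 : u ⬝ᵥ (dInv P k η * S⁻¹ * dInv P l η) *ᵥ u
      = u ⬝ᵥ (dInv P l η * S⁻¹ * dInv P k η) *ᵥ u := by
    rw [← quadForm_transpose]
    simp only [Matrix.transpose_mul, hS, transpose_dInv hsymm, Matrix.mul_assoc]
  have e2 : u ⬝ᵥ (ddInv P k l η * S⁻¹ * (P η)⁻¹) *ᵥ u
      = u ⬝ᵥ ((P η)⁻¹ * S⁻¹ * ddInv P k l η) *ᵥ u := by
    rw [← quadForm_transpose]
    simp only [Matrix.transpose_mul, hS, transpose_ddInv hsymm, hsymm.self_of_nhds,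
      Matrix.mul_assoc]
  simp only [zero_smul, add_zero, Matrix.add_mulVec, dotProduct_add, cMatrix, Matrix.of_apply,
    e1, e2]
  ring

lemma cMatrix_isSymm (u : Fin n → ℝ) (hS : (S⁻¹)ᵀ = S⁻¹)
    (hB : EntryContDiffAt 2 (fun η => (P η)⁻¹) η)
    (hsymm : ∀ᶠ ξ in 𝓝 η, ((P ξ)⁻¹)ᵀ = (P ξ)⁻¹) :
    (cMatrix σ S u P η)ᵀ = cMatrix σ S u P η := by
  have hf := contDiffAt_limitCost (σ := σ) (S := S) u hB
  have hd : DifferentiableAt ℝ (fderiv ℝ fun η => limitCost σ S u (P η)) η :=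
    (hf.fderiv_right (m := 1) (by norm_num)).differentiableAt one_ne_zero
  have key : ∀ k l, partialDeriv k (partialDeriv l fun η => limitCost σ S u (P η)) η =
      fderiv ℝ (fderiv ℝ fun η => limitCost σ S u (P η)) η (EuclideanSpace.single k 1)
        (EuclideanSpace.single l 1) := fun k l => by
    change fderiv ℝ (fun ξ => fderiv ℝ (fun η => limitCost σ S u (P η)) ξ
      (EuclideanSpace.single l 1)) η (EuclideanSpace.single k 1) = _
    rw [fderiv_clm_apply hd (differentiableAt_const _)]
    simp
  ext k l
  rw [Matrix.transpose_apply, cMatrix_eq_partialDeriv u hS hB hsymm,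
    cMatrix_eq_partialDeriv u hS hB hsymm, key, key]
  exact hf.isSymmSndFDerivAt (by simp) _ _

end LimitCost

/-! ### Minimizers under a perturbed cost -/

section Perturbation

variable {E X F : Type*} [NormedAddCommGroup E] [NormedSpace ℝ E] [NormedAddCommGroup X]
  [NormedSpace ℝ X] [NormedAddCommGroup F] [NormedSpace ℝ F]

/-- Points of a compact set whose perturbed cost does not exceed that of the unperturbed strict
minimizer `e₀` are close to `e₀`. -/
lemma eventually_mem_nhds_of_le {E X : Type*} [TopologicalSpace E] [TopologicalSpace X]
    {f : E × X → ℝ} {K : Set E} (hK : IsCompact K) {e₀ : E} {x₀ : X}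
    (he₀ : e₀ ∈ K) (hf : ∀ e ∈ K, ContinuousAt f (e, x₀))
    (hmin : ∀ e ∈ K, e ≠ e₀ → f (e₀, x₀) < f (e, x₀)) {U : Set E} (hU : U ∈ 𝓝 e₀) :
    ∀ᶠ x in 𝓝 x₀, ∀ e ∈ K, f (e, x) ≤ f (e₀, x) → e ∈ U := by
  have hK' : IsCompact (K \ interior U) := hK.diff isOpen_interior
  have h : ∀ᶠ x in 𝓝 x₀, ∀ e ∈ K \ interior U, f (e₀, x) < f (e, x) := by
    refine hK'.eventually_forall_of_forall_eventually fun e he => ?_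
    have hne : e ≠ e₀ := fun h => he.2 (h ▸ mem_interior_iff_mem_nhds.2 hU)
    have h1 : Tendsto (fun z : X × E => f (e₀, z.1)) (𝓝 (x₀, e)) (𝓝 (f (e₀, x₀))) :=
      (hf e₀ he₀).tendsto.comp
        ((continuous_const.prodMk continuous_fst).tendsto' (x₀, e) (e₀, x₀) rfl)
    have h2 : Tendsto (fun z : X × E => f (z.2, z.1)) (𝓝 (x₀, e)) (𝓝 (f (e, x₀))) :=
      (hf e he.1).tendsto.comp (continuous_swap.tendsto' (x₀, e) (e, x₀) rfl)
    exact h1.eventually_lt h2 (hmin e he.1 hne)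
  filter_upwards [h] with x hx e he hle
  by_contra hne
  exact absurd (hx e ⟨he, fun h => hne (interior_subset h)⟩) (not_lt.2 hle)

/-- First-order expansion of an implicitly defined zero `e` of `g (e, x) = 0`. Only
differentiability of `g` at the base point is needed, because the existence of the zeros is not
claimed. -/
lemma eventually_norm_le_of_hasFDerivAt {g : E × X → F} {g' : E × X →L[ℝ] F} {e₀ : E} {x₀ : X}
    (hg : HasFDerivAt g g' (e₀, x₀)) (h0 : g (e₀, x₀) = 0) (L : F →L[ℝ] E)
    (hL : ∀ h, L (g' (h, 0)) = h) {c : ℝ} (hc : 0 < c) :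
    ∀ᶠ ξ in 𝓝 (e₀, x₀), g ξ = 0 → ‖ξ.1 - e₀ + L (g' (0, ξ.2 - x₀))‖ ≤ c * ‖ξ.2 - x₀‖ := by
  set κ := ‖L.comp (g'.comp (ContinuousLinearMap.inr ℝ E X))‖ with hκ
  have hκ0 : 0 ≤ κ := norm_nonneg _
  -- `d ≤ 1 / 2` absorbs `ξ.1 - e₀` into the left-hand side; the other bound gives the constant `c`
  set d := min (1 / 2) (c / (2 * (κ + 1))) with hd
  have hd0 : 0 < d := by positivity
  have hd1 : d ≤ 1 / 2 := min_le_left _ _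
  have hd2 : d * (2 * (κ + 1)) ≤ c := by
    rw [← le_div_iff₀ (by positivity)]; exact min_le_right _ _
  have hlo := hg.isLittleO.def (c := d / (‖L‖ + 1)) (by positivity)
  filter_upwards [hlo] with ξ hξ hgξ
  rw [hgξ, h0, sub_zero, zero_sub, norm_neg] at hξ
  set h := ξ.1 - e₀
  set y := ξ.2 - x₀
  have hsplit : ξ - (e₀, x₀) = (h, 0) + (0, y) := by ext <;> simp [h, y]
  have hLg : L (g' (ξ - (e₀, x₀))) = h + L (g' (0, y)) := by
    rw [hsplit, map_add, map_add, hL]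
  have hnorm : ‖ξ - (e₀, x₀)‖ ≤ ‖h‖ + ‖y‖ := by
    rw [Prod.norm_def]
    exact max_le (le_add_of_nonneg_right (norm_nonneg _)) (le_add_of_nonneg_left (norm_nonneg _))
  have hw : ‖h + L (g' (0, y))‖ ≤ d * (‖h‖ + ‖y‖) := by
    rw [← hLg]
    calc ‖L (g' (ξ - (e₀, x₀)))‖ ≤ (‖L‖ + 1) * ‖g' (ξ - (e₀, x₀))‖ :=
          (L.le_opNorm _).trans (by gcongr; linarith)
      _ ≤ (‖L‖ + 1) * (d / (‖L‖ + 1) * (‖h‖ + ‖y‖)) := by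
          gcongr; exact hξ.trans (by gcongr)
      _ = d * (‖h‖ + ‖y‖) := by
          have := norm_nonneg L
          field_simp
  have hy : ‖L (g' (0, y))‖ ≤ κ * ‖y‖ :=
    (L.comp (g'.comp (ContinuousLinearMap.inr ℝ E X))).le_opNorm y
  have hh : ‖h‖ ≤ ‖h + L (g' (0, y))‖ + κ * ‖y‖ := by
    calc ‖h‖ = ‖(h + L (g' (0, y))) - L (g' (0, y))‖ := by rw [add_sub_cancel_right]
      _ ≤ _ := (norm_sub_le _ _).trans (by gcongr)
  have hfin : ‖h + L (g' (0, y))‖ ≤ d * (2 * (κ + 1)) * ‖y‖ := by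
    have h2 : d * ‖h‖ ≤ d * (‖h + L (g' (0, y))‖ + κ * ‖y‖) := by gcongr
    nlinarith [norm_nonneg (h + L (g' (0, y))), norm_nonneg y]
  exact hfin.trans (by gcongr)

end Perturbation

/-! ### The gradient of the reduced cost -/

section Gradient

variable {n p : ℕ} {σ : ℝ} {θ₀ : Fin n → ℝ} {S : Matrix (Fin n) (Fin n) ℝ}
  {P : EuclideanSpace ℝ (Fin p) → Matrix (Fin n) (Fin n) ℝ} {η : EuclideanSpace ℝ (Fin p)}

/-- The statistics at the limit `R = Σ`, `e = 0`, with the noise correlation `z` left free. -/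
def limitStat (S : Matrix (Fin n) (Fin n) ℝ) (z : EuclideanSpace ℝ (Fin n)) : Stat n :=
  (z, fun i j => S i j, 0)

lemma reducedCostAt_limitStat (hS : S.PosDef) (z : EuclideanSpace ℝ (Fin n))
    (η : EuclideanSpace ℝ (Fin p)) :
    reducedCostAt σ θ₀ P (η, limitStat S z) =
      limitCost σ S (θ₀ + S⁻¹ *ᵥ WithLp.ofLp z) (P η) := by
  have hSu := isUnit_det_of_posDef hS
  have hof : Matrix.of (fun i j => S i j) = S := rfl
  set B := (P η)⁻¹ with hB
  simp only [reducedCostAt, reducedCost, limitStat, limitCost, hof, zero_smul, add_zero, ← hB]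
  set u := θ₀ + S⁻¹ *ᵥ WithLp.ofLp z
  rw [Matrix.mulVec_mulVec, Matrix.mul_nonsing_inv_cancel_left _ _ hSu, dotProduct_comm,
    ← Matrix.mulVec_mulVec, Matrix.mul_assoc, ← Matrix.mulVec_mulVec u Bᵀ,
    Matrix.dotProduct_mulVec u, Matrix.vecMul_transpose]
  rw [← Matrix.mulVec_mulVec]

/-- The gradient of the reduced cost in the hyper-parameter. -/
noncomputable def reducedGrad (σ : ℝ) (θ₀ : Fin n → ℝ)
    (P : EuclideanSpace ℝ (Fin p) → Matrix (Fin n) (Fin n) ℝ)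
    (ξ : EuclideanSpace ℝ (Fin p) × Stat n) : Fin p → ℝ :=
  fun l => fderiv ℝ (reducedCostAt σ θ₀ P) ξ (EuclideanSpace.single l 1, 0)

lemma reducedGrad_eq_partialDeriv {ξ : EuclideanSpace ℝ (Fin p) × Stat n}
    (h : DifferentiableAt ℝ (reducedCostAt σ θ₀ P) ξ) (l : Fin p) :
    reducedGrad σ θ₀ P ξ l =
      partialDeriv l (fun η => reducedCostAt σ θ₀ P (η, ξ.2)) ξ.1 := by
  have h2 : HasFDerivAt (fun η => reducedCostAt σ θ₀ P (η, ξ.2))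
      ((fderiv ℝ (reducedCostAt σ θ₀ P) ξ).comp (ContinuousLinearMap.inl ℝ _ _)) ξ.1 :=
    HasFDerivAt.comp (g := reducedCostAt σ θ₀ P) ξ.1 h.hasFDerivAt
      (hasFDerivAt_prodMk_left ξ.1 ξ.2)
  rw [partialDeriv, h2.fderiv]
  simp [reducedGrad]

lemma reducedGrad_eq_zero {ξ : EuclideanSpace ℝ (Fin p) × Stat n}
    (h : DifferentiableAt ℝ (reducedCostAt σ θ₀ P) ξ)
    (hmin : IsLocalMin (fun η => reducedCostAt σ θ₀ P (η, ξ.2)) ξ.1) :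
    reducedGrad σ θ₀ P ξ = 0 := by
  ext l
  rw [reducedGrad_eq_partialDeriv h, partialDeriv, hmin.fderiv_eq_zero]
  simp

lemma contDiffAt_reducedCostAt_limitStat (hS : S.PosDef) {k : WithTop ℕ∞}
    (hB : EntryContDiffAt k (fun η => (P η)⁻¹) η) (z : EuclideanSpace ℝ (Fin n)) :
    ContDiffAt ℝ k (reducedCostAt σ θ₀ P) (η, limitStat S z) := by
  have hof : Matrix.of (fun i j => S i j) = S := rfl
  refine contDiffAt_reducedCostAt hB ?_ ?_ <;> simp [limitStat, hof, hS.det_pos.ne']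

lemma differentiableAt_reducedGrad {ξ : EuclideanSpace ℝ (Fin p) × Stat n}
    (h : ContDiffAt ℝ 2 (reducedCostAt σ θ₀ P) ξ) :
    DifferentiableAt ℝ (reducedGrad σ θ₀ P) ξ := by
  refine differentiableAt_pi.2 fun l => ?_
  exact ((h.fderiv_right (m := 1) (by norm_num)).clm_apply contDiffAt_const).differentiableAt
    one_ne_zero

lemma reducedGrad_limitStat (hS : S.PosDef)
    (hB : EntryContDiffAt 1 (fun η => (P η)⁻¹) η) (z : EuclideanSpace ℝ (Fin n)) (l : Fin p) :
    reducedGrad σ θ₀ P (η, limitStat S z) l =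
      partialDeriv l (fun η => limitCost σ S (θ₀ + S⁻¹ *ᵥ WithLp.ofLp z) (P η)) η := by
  rw [reducedGrad_eq_partialDeriv
    ((contDiffAt_reducedCostAt_limitStat hS hB z).differentiableAt one_ne_zero)]
  simp only [reducedCostAt_limitStat hS]

/-- The Hessian block of the derivative of the gradient is `C_y`. -/
lemma fderiv_reducedGrad_hyper (hS : S.PosDef)
    (hB : EntryContDiffAt 2 (fun η => (P η)⁻¹) η)
    (hsymm : ∀ᶠ ξ in 𝓝 η, ((P ξ)⁻¹)ᵀ = (P ξ)⁻¹) (h : EuclideanSpace ℝ (Fin p)) :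
    fderiv ℝ (reducedGrad σ θ₀ P) (η, limitStat S 0) (h, 0) =
      cMatrix σ S θ₀ P η *ᵥ WithLp.ofLp h := by
  have hSt : (S⁻¹)ᵀ = S⁻¹ := by simpa using hS.inv.isHermitian.eq
  have hd := differentiableAt_reducedGrad
    (contDiffAt_reducedCostAt_limitStat (σ := σ) (θ₀ := θ₀) hS hB 0)
  have hB1 : ∀ᶠ ξ in 𝓝 η, EntryContDiffAt 1 (fun η => (P η)⁻¹) ξ := by
    refine Filter.eventually_all.2 fun i => Filter.eventually_all.2 fun j => ?_
    exact ((hB i j).of_le one_le_two).eventually (by simp)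
  have hcomp : HasFDerivAt (fun ξ => reducedGrad σ θ₀ P (ξ, limitStat S 0))
      ((fderiv ℝ (reducedGrad σ θ₀ P) (η, limitStat S 0)).comp
        (ContinuousLinearMap.inl ℝ _ _)) η :=
    HasFDerivAt.comp (g := reducedGrad σ θ₀ P) η hd.hasFDerivAt (hasFDerivAt_prodMk_left η _)
  have hbasis : ∀ k l, fderiv ℝ (reducedGrad σ θ₀ P) (η, limitStat S 0)
      (EuclideanSpace.single k 1, 0) l = cMatrix σ S θ₀ P η k l := fun k l => by
    have hl := (hasFDerivAt_pi'.1 hcomp) l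
    have hev : (fun ξ => reducedGrad σ θ₀ P (ξ, limitStat S 0) l) =ᶠ[𝓝 η]
        partialDeriv l fun η => limitCost σ S θ₀ (P η) := by
      filter_upwards [hB1] with ξ hξ
      rw [reducedGrad_limitStat hS hξ]; simp
    rw [cMatrix_eq_partialDeriv θ₀ hSt hB hsymm, ← partialDeriv_congr hev, partialDeriv, hl.fderiv]
    simp
  have hsum : (h, (0 : Stat n)) =
      ∑ k, h k • ((EuclideanSpace.single k (1 : ℝ), 0) : EuclideanSpace ℝ (Fin p) × Stat n) := by
    refine Prod.ext ?_ ?_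
    · simp only [Prod.fst_sum, Prod.smul_fst]
      ext i
      simp [Finset.sum_apply, Pi.single_apply]
    · simp [Prod.snd_sum]
  ext l
  -- the coordinates produce `C_yᵀ h`, which is `C_y h` because the Hessian is symmetric
  rw [← cMatrix_isSymm (σ := σ) θ₀ hSt hB hsymm]
  rw [hsum, map_sum]
  simp only [map_smul, Finset.sum_apply, Pi.smul_apply, smul_eq_mul, hbasis, Matrix.mulVec,
    dotProduct, Matrix.transpose_apply]
  exact Finset.sum_congr rfl fun k _ => mul_comm _ _

/-- The matrix whose `l`-th row is `∂(P⁻¹ Σ⁻¹ P⁻¹)/∂η_l θ₀`. -/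
noncomputable def dInvSqRows (S : Matrix (Fin n) (Fin n) ℝ) (θ₀ : Fin n → ℝ)
    (P : EuclideanSpace ℝ (Fin p) → Matrix (Fin n) (Fin n) ℝ) (η : EuclideanSpace ℝ (Fin p)) :
    Matrix (Fin p) (Fin n) ℝ :=
  Matrix.of fun l => dInvSq S P l η *ᵥ θ₀

/-- The mixed block of the derivative of the gradient, in the direction of the noise
correlation. -/
lemma fderiv_reducedGrad_noise (hS : S.PosDef)
    (hB : EntryContDiffAt 2 (fun η => (P η)⁻¹) η)
    (hsymm : ∀ᶠ ξ in 𝓝 η, ((P ξ)⁻¹)ᵀ = (P ξ)⁻¹) (w : EuclideanSpace ℝ (Fin n)) :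
    fderiv ℝ (reducedGrad σ θ₀ P) (η, limitStat S 0) (0, w, 0) =
      (2 * σ ^ 4) • ((dInvSqRows S θ₀ P η * S⁻¹) *ᵥ WithLp.ofLp w) := by
  have hSt : (S⁻¹)ᵀ = S⁻¹ := by simpa using hS.inv.isHermitian.eq
  have hd := differentiableAt_reducedGrad
    (contDiffAt_reducedCostAt_limitStat (σ := σ) (θ₀ := θ₀) hS hB 0)
  have hB1 : EntryContDiffAt 1 (fun η => (P η)⁻¹) η := fun i j => (hB i j).of_le one_le_two
  have hline := hd.hasFDerivAt.hasLineDerivAt ((0, w, 0) : EuclideanSpace ℝ (Fin p) × Stat n)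
  ext l
  have hl := (hasDerivAt_pi.1 hline) l
  refine hl.unique ?_
  have hpt : ∀ t : ℝ, (η, limitStat S 0) + t • ((0, w, 0) : EuclideanSpace ℝ (Fin p) × Stat n) =
      (η, limitStat S (t • w)) := fun t => by
    ext <;> simp [limitStat]
  simp only [hpt, reducedGrad_limitStat hS hB1, partialDeriv_limitCost _ hB1 hsymm]
  set A := dInvSq S P l η with hA
  set v := S⁻¹ *ᵥ WithLp.ofLp w with hv
  have hsym : v ⬝ᵥ A *ᵥ θ₀ = θ₀ ⬝ᵥ A *ᵥ v := by
    rw [Matrix.dotProduct_mulVec, ← Matrix.mulVec_transpose, transpose_dInvSq hSt hsymm,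
      dotProduct_comm]
  have hexp : ∀ t : ℝ, (θ₀ + S⁻¹ *ᵥ WithLp.ofLp (t • w)) ⬝ᵥ
      A *ᵥ (θ₀ + S⁻¹ *ᵥ WithLp.ofLp (t • w)) =
      θ₀ ⬝ᵥ A *ᵥ θ₀ + 2 * (v ⬝ᵥ A *ᵥ θ₀) * t + (v ⬝ᵥ A *ᵥ v) * t ^ 2 := fun t => by
    rw [WithLp.ofLp_smul, Matrix.mulVec_smul, ← hv, Matrix.mulVec_add, Matrix.mulVec_smul,
      add_dotProduct, dotProduct_add, dotProduct_add, smul_dotProduct, dotProduct_smul,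
      smul_dotProduct, dotProduct_smul, ← hsym]
    simp only [smul_eq_mul]; ring
  simp only [hexp]
  have hpoly : HasDerivAt (fun t : ℝ => θ₀ ⬝ᵥ A *ᵥ θ₀ + 2 * (v ⬝ᵥ A *ᵥ θ₀) * t
      + (v ⬝ᵥ A *ᵥ v) * t ^ 2) (2 * (v ⬝ᵥ A *ᵥ θ₀)) 0 := by
    have := (((hasDerivAt_id (0 : ℝ)).const_mul (2 * (v ⬝ᵥ A *ᵥ θ₀))).const_add
      (θ₀ ⬝ᵥ A *ᵥ θ₀)).add (((hasDerivAt_id (0 : ℝ)).pow 2).const_mul (v ⬝ᵥ A *ᵥ v))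
    exact this.congr_deriv (by simp)
  refine ((hpoly.const_mul (σ ^ 4)).sub_const _).congr_deriv ?_
  have : ((dInvSqRows S θ₀ P η * S⁻¹) *ᵥ WithLp.ofLp w) l = v ⬝ᵥ A *ᵥ θ₀ := by
    rw [← Matrix.mulVec_mulVec, ← hv, dotProduct_comm]
    rfl
  rw [Pi.smul_apply, this, smul_eq_mul]
  ring

end Gradient

/-! ### The limit law of the noise correlation -/

section Noise

/-- The noise correlation `ΦᵀV / N`. -/
noncomputable def noiseCorr {n : ℕ} (φ : ℕ → Fin n → ℝ) (v : ℕ → ℝ) (N : ℕ) :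
    EuclideanSpace ℝ (Fin n) :=
  WithLp.toLp 2 ((N : ℝ)⁻¹ • ((regMatrix φ N)ᵀ *ᵥ fun t : Fin N => v t))

/-- The empirical regressor covariance `ΦᵀΦ / N`. -/
noncomputable def empCov {n : ℕ} (φ : ℕ → Fin n → ℝ) (N : ℕ) : Matrix (Fin n) (Fin n) ℝ :=
  (N : ℝ)⁻¹ • ((regMatrix φ N)ᵀ * regMatrix φ N)

variable {n : ℕ}

lemma inner_sqrt_smul_noiseCorr (φ : ℕ → Fin n → ℝ) (v : ℕ → ℝ) (N : ℕ)
    (c : EuclideanSpace ℝ (Fin n)) :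
    inner ℝ (Real.sqrt N • noiseCorr φ v N) c =
      ∑ t ∈ Finset.range N, (Real.sqrt N * (N : ℝ)⁻¹ * (φ t ⬝ᵥ WithLp.ofLp c)) * v t := by
  rw [inner_smul_left, noiseCorr, EuclideanSpace.inner_eq_star_dotProduct]
  simp only [star_trivial, dotProduct_smul, smul_eq_mul, conj_trivial]
  rw [Matrix.dotProduct_mulVec, Matrix.vecMul_transpose, Finset.sum_range, dotProduct,
    ← mul_assoc, Finset.mul_sum]
  refine Finset.sum_congr rfl fun t _ => ?_
  change Real.sqrt N * (N : ℝ)⁻¹ * ((φ t ⬝ᵥ WithLp.ofLp c) * v t) = _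
  ring

lemma sum_sq_eq_quadForm_empCov (φ : ℕ → Fin n → ℝ) (N : ℕ) (c : Fin n → ℝ) :
    ∑ t ∈ Finset.range N, (Real.sqrt N * (N : ℝ)⁻¹ * (φ t ⬝ᵥ c)) ^ 2 = c ⬝ᵥ empCov φ N *ᵥ c := by
  rcases Nat.eq_zero_or_pos N with rfl | hN
  · simp [empCov]
  have hs : (Real.sqrt N * (N : ℝ)⁻¹) ^ 2 = (N : ℝ)⁻¹ := by
    rw [mul_pow, Real.sq_sqrt (Nat.cast_nonneg N)]
    field_simp
  rw [empCov, Matrix.smul_mulVec, dotProduct_smul, ← Matrix.mulVec_mulVec,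
    Matrix.dotProduct_mulVec, Matrix.vecMul_transpose, ← sum_sq_eq_dotProduct, smul_eq_mul,
    Finset.mul_sum, Finset.sum_range]
  refine Finset.sum_congr rfl fun t _ => ?_
  rw [mul_pow, hs]
  rfl

variable {α : Type*} [MeasurableSpace α] {μ : Measure α}
  {σ : ℝ} {φ : ℕ → α → Fin n → ℝ} {v : ℕ → α → ℝ}

lemma integral_cexp_sum_gaussian (hv : ∀ t, HasLaw (v t) (gaussianReal 0 (σ ^ 2).toNNReal) μ)
    (hv_indep : iIndepFun v μ) (a : ℕ → ℝ) (N : ℕ) :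
    ∫ ω, Complex.exp ((∑ t ∈ Finset.range N, a t * v t ω : ℝ) * Complex.I) ∂μ =
      Complex.exp ((-(σ ^ 2 / 2 * ∑ t ∈ Finset.range N, a t ^ 2) : ℝ)) := by
  have hm : ∀ t, AEMeasurable (fun ω => a t * v t ω) μ := fun t => (hv t).aemeasurable.const_mul _
  have hind : iIndepFun (fun t ω => a t * v t ω) μ :=
    hv_indep.comp (fun t x => a t * x) fun t => measurable_const_mul _
  have h := iIndepFun.charFun_map_fun_finsetSum_eq_prod (s := Finset.range N)
    (X := fun t ω => a t * v t ω) (fun t _ => hm t) (hind.restrict _)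
  have h1 := congrFun h 1
  rw [charFun_apply_real, integral_map (Finset.aemeasurable_fun_sum _ fun t _ => hm t)
    (by fun_prop), Finset.prod_apply] at h1
  simp only [Complex.ofReal_one, one_mul] at h1
  rw [h1]
  have h2 : ∀ t, charFun (μ.map fun ω => a t * v t ω) 1 =
      Complex.exp (((-(σ ^ 2 / 2 * a t ^ 2) : ℝ)) : ℂ) := fun t => by
    rw [charFun_map_mul_comp (hv t).aemeasurable, (hv t).map_eq, charFun_gaussianReal]
    have : (((σ ^ 2).toNNReal : ℝ) : ℂ) = (σ : ℂ) ^ 2 := by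
      rw [Real.coe_toNNReal _ (sq_nonneg σ)]; push_cast; rfl
    congr 1
    rw [this]
    push_cast
    ring
  simp only [h2]
  rw [← Complex.exp_sum, Finset.mul_sum, ← Finset.sum_neg_distrib, Complex.ofReal_sum]

lemma aemeasurable_noiseCorr (hφ : ∀ t, Measurable (φ t)) (hv : ∀ t, AEMeasurable (v t) μ)
    (N : ℕ) : AEMeasurable (fun ω => noiseCorr (fun t => φ t ω) (fun t => v t ω) N) μ := by
  refine (WithLp.measurable_toLp 2 _).comp_aemeasurable ?_
  refine aemeasurable_pi_lambda _ fun i => ?_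
  simp only [Pi.smul_apply, Matrix.mulVec, dotProduct, regMatrix, Matrix.transpose_apply,
    Matrix.of_apply, smul_eq_mul]
  refine AEMeasurable.const_mul (Finset.aemeasurable_fun_sum _ fun t _ => ?_) _
  exact (((measurable_pi_apply i).comp (hφ t)).aemeasurable).mul (hv t)

/-- Conditionally on the regressors the noise correlation is Gaussian, so its characteristic
function is the mean of Gaussian characteristic functions. -/
lemma charFun_sqrt_smul_noiseCorr [IsProbabilityMeasure μ] (hφ : ∀ t, Measurable (φ t))
    (hv : ∀ t, HasLaw (v t) (gaussianReal 0 (σ ^ 2).toNNReal) μ)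
    (hv_indep : iIndepFun v μ)
    (hφv : IndepFun (fun ω t => φ t ω) (fun ω t => v t ω) μ) (N : ℕ)
    (c : EuclideanSpace ℝ (Fin n)) :
    charFun (μ.map fun ω => Real.sqrt N • noiseCorr (fun t => φ t ω) (fun t => v t ω) N) c =
      ∫ ω, Complex.exp ((-(σ ^ 2 / 2 *
        (WithLp.ofLp c ⬝ᵥ empCov (fun t => φ t ω) N *ᵥ WithLp.ofLp c)) : ℝ)) ∂μ := by
  have hvm : ∀ t, AEMeasurable (v t) μ := fun t => (hv t).aemeasurable
  have hφm : Measurable (fun ω t => φ t ω) := measurable_pi_lambda _ hφ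
  have hvm' : AEMeasurable (fun ω t => v t ω) μ := aemeasurable_pi_lambda _ hvm
  have hZ : AEMeasurable (fun ω => Real.sqrt N • noiseCorr (fun t => φ t ω) (fun t => v t ω) N) μ :=
    (aemeasurable_noiseCorr hφ hvm N).const_smul (Real.sqrt N)
  rw [charFun_apply, integral_map hZ (by fun_prop)]
  simp only [inner_sqrt_smul_noiseCorr]
  set a : (ℕ → Fin n → ℝ) → ℕ → ℝ := fun x t =>
    Real.sqrt N * (N : ℝ)⁻¹ * (x t ⬝ᵥ WithLp.ofLp c) with ha
  have ham : ∀ t, Measurable fun x : ℕ → Fin n → ℝ => a x t := fun t => by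
    simp only [ha, dotProduct]; fun_prop
  set f : (ℕ → Fin n → ℝ) × (ℕ → ℝ) → ℂ := fun q =>
    Complex.exp ((∑ t ∈ Finset.range N, a q.1 t * q.2 t : ℝ) * Complex.I) with hf
  have hfm : Measurable f := by
    have : ∀ t, Measurable fun q : (ℕ → Fin n → ℝ) × (ℕ → ℝ) => a q.1 t :=
      fun t => (ham t).comp measurable_fst
    have h2 : Measurable fun q : (ℕ → Fin n → ℝ) × (ℕ → ℝ) =>
        ∑ t ∈ Finset.range N, a q.1 t * q.2 t :=
      Finset.measurable_fun_sum _ fun t _ =>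
        (this t).mul ((measurable_pi_apply t).comp measurable_snd)
    simp only [hf]
    fun_prop
  have hprod := (indepFun_iff_map_prod_eq_prod_map_map hφm.aemeasurable hvm').1 hφv
  have : IsProbabilityMeasure (μ.map fun ω t => φ t ω) :=
    Measure.isProbabilityMeasure_map hφm.aemeasurable
  have : IsProbabilityMeasure (μ.map fun ω t => v t ω) := Measure.isProbabilityMeasure_map hvm'
  have hint : Integrable f ((μ.map fun ω t => φ t ω).prod (μ.map fun ω t => v t ω)) := by
    refine Integrable.of_bound hfm.aestronglyMeasurable 1 (ae_of_all _ fun q => ?_)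
    simp only [hf, Complex.norm_exp_ofReal_mul_I, le_refl]
  calc ∫ ω, f (fun t => φ t ω, fun t => v t ω) ∂μ
      = ∫ q, f q ∂(μ.map fun ω => (fun t => φ t ω, fun t => v t ω)) :=
        (integral_map (hφm.aemeasurable.prodMk hvm') hfm.aestronglyMeasurable).symm
    _ = ∫ x, ∫ y, f (x, y) ∂(μ.map fun ω t => v t ω) ∂(μ.map fun ω t => φ t ω) := by
        rw [hprod, integral_prod _ hint]
    _ = ∫ x, Complex.exp ((-(σ ^ 2 / 2 * ∑ t ∈ Finset.range N, a x t ^ 2) : ℝ))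
          ∂(μ.map fun ω t => φ t ω) := by
        refine integral_congr_ae (ae_of_all _ fun x => ?_)
        refine (integral_map (f := fun y => f (x, y)) hvm'
          (hfm.comp measurable_prodMk_left).aestronglyMeasurable).trans ?_
        exact integral_cexp_sum_gaussian hv hv_indep (a x) N
    _ = _ := by
        rw [integral_map hφm.aemeasurable
          (Measurable.aestronglyMeasurable (by fun_prop))]
        simp only [ha, sum_sq_eq_quadForm_empCov]

lemma tendsto_charFun_sqrt_smul_noiseCorr [IsProbabilityMeasure μ] (hφ : ∀ t, Measurable (φ t))
    (hv : ∀ t, HasLaw (v t) (gaussianReal 0 (σ ^ 2).toNNReal) μ)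
    (hv_indep : iIndepFun v μ)
    (hφv : IndepFun (fun ω t => φ t ω) (fun ω t => v t ω) μ)
    {S : Matrix (Fin n) (Fin n) ℝ}
    (hconv : ∀ᵐ ω ∂μ, Tendsto (fun N => empCov (fun t => φ t ω) N) atTop (𝓝 S))
    (c : EuclideanSpace ℝ (Fin n)) :
    Tendsto (fun N : ℕ => charFun
        (μ.map fun ω => Real.sqrt N • noiseCorr (fun t => φ t ω) (fun t => v t ω) N) c)
      atTop (𝓝 (Complex.exp
        ((-(σ ^ 2 / 2 * (WithLp.ofLp c ⬝ᵥ S *ᵥ WithLp.ofLp c)) : ℝ)))) := by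
  simp only [charFun_sqrt_smul_noiseCorr hφ hv hv_indep hφv]
  have hcont : Continuous fun R : Matrix (Fin n) (Fin n) ℝ =>
      Complex.exp ((-(σ ^ 2 / 2 * (WithLp.ofLp c ⬝ᵥ R *ᵥ WithLp.ofLp c)) : ℝ)) := by
    fun_prop
  have hlim : ∫ _ω : α, Complex.exp
        ((-(σ ^ 2 / 2 * (WithLp.ofLp c ⬝ᵥ S *ᵥ WithLp.ofLp c)) : ℝ)) ∂μ =
      Complex.exp ((-(σ ^ 2 / 2 * (WithLp.ofLp c ⬝ᵥ S *ᵥ WithLp.ofLp c)) : ℝ)) := by simp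
  rw [← hlim]
  refine tendsto_integral_of_dominated_convergence (fun _ => 1) (fun N => ?_)
    (integrable_const _) (fun N => ae_of_all _ fun ω => ?_) ?_
  · simp only [← sum_sq_eq_quadForm_empCov]
    refine Measurable.aestronglyMeasurable ?_
    have : ∀ t, Measurable fun ω => φ t ω ⬝ᵥ WithLp.ofLp c := fun t => by
      simp only [dotProduct]
      exact Finset.measurable_fun_sum _ fun i _ =>
        ((measurable_pi_apply i).comp (hφ t)).mul_const _
    fun_prop
  · rw [← sum_sq_eq_quadForm_empCov, Complex.norm_exp, Complex.ofReal_re, Real.exp_le_one_iff,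
      neg_nonpos]
    positivity
  · filter_upwards [hconv] with ω hω
    exact (hcont.tendsto S).comp hω

end Noise

/-! ### Convergence in probability and in distribution -/

section InProbability

variable {α : Type*} [MeasurableSpace α] {μ : Measure α}

/-- Pointwise convergence of the characteristic functions to a function continuous at the origin
gives boundedness in probability. -/
lemma exists_forall_measure_norm_gt_le [IsProbabilityMeasure μ] {E : Type*} [NormedAddCommGroup E]
    [InnerProductSpace ℝ E] [FiniteDimensional ℝ E] [MeasurableSpace E] [BorelSpace E]
    {Z : ℕ → α → E} (hZ : ∀ N, AEMeasurable (Z N) μ) {f : E → ℂ} (hf : ContinuousAt f 0)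
    (h : ∀ c, Tendsto (fun N => charFun (μ.map (Z N)) c) atTop (𝓝 (f c)))
    {ε : ENNReal} (hε : 0 < ε) : ∃ L : ℝ, ∀ N, μ {ω | L < ‖Z N ω‖} ≤ ε := by
  have (N : ℕ) : IsProbabilityMeasure (μ.map (Z N)) := Measure.isProbabilityMeasure_map (hZ N)
  have ht := tendsto_measure_norm_gt_of_isTightMeasureSet
    (isTightMeasureSet_of_tendsto_charFun hf h)
  obtain ⟨L, hL⟩ := (ENNReal.tendsto_nhds_zero.1 ht ε hε).exists
  refine ⟨L, fun N => ?_⟩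
  have h1 : μ.map (Z N) {x | L < ‖x‖} ≤ ε :=
    (le_iSup₂ (f := fun (ν : Measure E) (_ : ν ∈ Set.range fun N => μ.map (Z N)) =>
      ν {x | L < ‖x‖}) (μ.map (Z N)) ⟨N, rfl⟩).trans hL
  rwa [Measure.map_apply_of_aemeasurable (hZ N)
    (measurableSet_lt measurable_const measurable_norm)] at h1

lemma tendsto_measure_compl_of_bounded {X : Type*} [NormedAddCommGroup X] {y : ℕ → α → X}
    {r : ℕ → ℝ} (hr : Tendsto r atTop atTop)
    (hy : ∀ ε : ENNReal, 0 < ε → ∃ L : ℝ, ∀ᶠ N in atTop, μ {ω | L < r N * ‖y N ω‖} ≤ ε)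
    {U : Set X} (hU : U ∈ 𝓝 0) :
    Tendsto (fun N => μ {ω | y N ω ∉ U}) atTop (𝓝 0) := by
  obtain ⟨ρ, hρ, hball⟩ := Metric.mem_nhds_iff.1 hU
  refine ENNReal.tendsto_nhds_zero.2 fun ε hε => ?_
  obtain ⟨L, hL⟩ := hy ε hε
  filter_upwards [hL, hr.eventually_gt_atTop (L / ρ), hr.eventually_gt_atTop 0] with N h1 h2 h3
  refine (measure_mono fun ω hω => ?_).trans h1
  have : ρ ≤ ‖y N ω‖ := by
    by_contra! hlt
    exact hω (hball (by simpa using hlt))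
  rw [div_lt_iff₀ hρ] at h2
  exact h2.trans_le (by gcongr)

/-- If `e + A y` is negligible relative to `y` in probability, `r y` is bounded in probability and
`r q` vanishes in probability, then `r (e + A (y - q))` vanishes in probability. -/
lemma tendstoInMeasure_of_expansion {E X : Type*} [NormedAddCommGroup E] [NormedSpace ℝ E]
    [NormedAddCommGroup X] [NormedSpace ℝ X] {e : ℕ → α → E} {y q : ℕ → α → X} {r : ℕ → ℝ}
    (hr : ∀ N, 0 ≤ r N) (A : X →L[ℝ] E)
    (hexp : ∀ c : ℝ, 0 < c →
      Tendsto (fun N => μ {ω | ¬ ‖e N ω + A (y N ω)‖ ≤ c * ‖y N ω‖}) atTop (𝓝 0))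
    (hy : ∀ ε : ENNReal, 0 < ε → ∃ L : ℝ, ∀ᶠ N in atTop, μ {ω | L < r N * ‖y N ω‖} ≤ ε)
    (hq : ∀ a : ℝ, 0 < a → Tendsto (fun N => μ {ω | a ≤ r N * ‖q N ω‖}) atTop (𝓝 0)) :
    TendstoInMeasure μ (fun N ω => r N • (e N ω + A (y N ω - q N ω))) atTop 0 := by
  refine tendstoInMeasure_iff_norm.2 fun a ha => ENNReal.tendsto_nhds_zero.2 fun ε hε => ?_
  have hε3 : 0 < ε / 3 := ENNReal.div_pos hε.ne' (by norm_num)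
  obtain ⟨L₀, hL₀⟩ := hy (ε / 3) hε3
  set L := max L₀ 1 with hLdef
  have hL1 : 0 < L := lt_of_lt_of_le one_pos (le_max_right _ _)
  have hA := norm_nonneg A
  -- off the three exceptional events the norm is at most `a / 2 + a / 4`
  have h1 := ENNReal.tendsto_nhds_zero.1 (hexp (a / (2 * L)) (by positivity)) _ hε3
  have h2 := ENNReal.tendsto_nhds_zero.1 (hq (a / (4 * (‖A‖ + 1))) (by positivity)) _ hε3
  filter_upwards [h1, h2, hL₀] with N h1 h2 h3
  have hsub : {ω | a ≤ ‖r N • (e N ω + A (y N ω - q N ω)) - (0 : α → E) ω‖} ⊆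
      ({ω | ¬ ‖e N ω + A (y N ω)‖ ≤ a / (2 * L) * ‖y N ω‖} ∪ {ω | L₀ < r N * ‖y N ω‖}) ∪
        {ω | a / (4 * (‖A‖ + 1)) ≤ r N * ‖q N ω‖} := by
    intro ω hω
    by_contra hcon
    simp only [Set.mem_union, Set.mem_ofPred_eq, not_or, not_lt, not_le] at hcon
    obtain ⟨⟨k1, k2⟩, k3⟩ := hcon
    simp only [Set.mem_ofPred_eq, Pi.zero_apply, sub_zero] at hω
    have k2' : r N * ‖y N ω‖ ≤ L := k2.trans (le_max_left _ _)
    have e1 : r N * ‖e N ω + A (y N ω)‖ ≤ a / 2 := by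
      calc r N * ‖e N ω + A (y N ω)‖ ≤ r N * (a / (2 * L) * ‖y N ω‖) := by
            gcongr; exact hr N
        _ = a / (2 * L) * (r N * ‖y N ω‖) := by ring
        _ ≤ a / (2 * L) * L := by gcongr
        _ = a / 2 := by field_simp
    have e2 : r N * ‖A (q N ω)‖ ≤ a / 4 := by
      calc r N * ‖A (q N ω)‖ ≤ r N * ((‖A‖ + 1) * ‖q N ω‖) := by
            gcongr
            · exact hr N
            · exact (A.le_opNorm _).trans (by gcongr; linarith)
        _ = (‖A‖ + 1) * (r N * ‖q N ω‖) := by ring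
        _ ≤ (‖A‖ + 1) * (a / (4 * (‖A‖ + 1))) := by gcongr
        _ = a / 4 := by field_simp
    have e3 : ‖r N • (e N ω + A (y N ω - q N ω))‖ ≤
        r N * ‖e N ω + A (y N ω)‖ + r N * ‖A (q N ω)‖ := by
      rw [norm_smul, Real.norm_of_nonneg (hr N), ← mul_add, map_sub, ← add_sub_assoc]
      exact mul_le_mul_of_nonneg_left (norm_sub_le _ _) (hr N)
    linarith
  calc _ ≤ _ := measure_mono hsub
    _ ≤ ε / 3 + ε / 3 + ε / 3 :=
        (measure_union_le _ _).trans
          (add_le_add ((measure_union_le _ _).trans (add_le_add h1 h3)) h2)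
    _ = ε := ENNReal.add_thirds ε

/-- Lévy's theorem for linear images of a sequence whose characteristic functions converge to a
centred Gaussian one. -/
lemma tendstoInDistribution_mulVec_gaussian [IsProbabilityMeasure μ] {n p : ℕ}
    {Z : ℕ → α → EuclideanSpace ℝ (Fin n)} (hZ : ∀ N, AEMeasurable (Z N) μ)
    {S : Matrix (Fin n) (Fin n) ℝ} {σ : ℝ}
    (h : ∀ c : EuclideanSpace ℝ (Fin n), Tendsto (fun N => charFun (μ.map (Z N)) c) atTop
      (𝓝 (Complex.exp ((-(σ ^ 2 / 2 * (WithLp.ofLp c ⬝ᵥ S *ᵥ WithLp.ofLp c)) : ℝ)))))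
    (J : Matrix (Fin p) (Fin n) ℝ) {Γ : Matrix (Fin p) (Fin p) ℝ} (hΓ : Γ.PosSemidef)
    (hΓJ : Γ = σ ^ 2 • (J * S * Jᵀ)) :
    TendstoInDistribution (fun N ω => WithLp.toLp 2 (J *ᵥ WithLp.ofLp (Z N ω))) atTop
      (id : EuclideanSpace ℝ (Fin p) → EuclideanSpace ℝ (Fin p)) (fun _ => μ)
      (multivariateGaussian 0 Γ) := by
  have hJm : Measurable fun x : EuclideanSpace ℝ (Fin n) =>
      (WithLp.toLp 2 (J *ᵥ WithLp.ofLp x) : EuclideanSpace ℝ (Fin p)) :=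
    Continuous.measurable (by fun_prop)
  have hm : ∀ N, AEMeasurable (fun ω => (WithLp.toLp 2 (J *ᵥ WithLp.ofLp (Z N ω)) :
      EuclideanSpace ℝ (Fin p))) μ := fun N => hJm.comp_aemeasurable (hZ N)
  refine ⟨hm, aemeasurable_id, ProbabilityMeasure.tendsto_of_tendsto_charFun fun t => ?_⟩
  simp only [ProbabilityMeasure.coe_mk, Measure.map_id]
  rw [charFun_multivariateGaussian hΓ]
  have hinner : ∀ x : EuclideanSpace ℝ (Fin n),
      inner ℝ (WithLp.toLp 2 (J *ᵥ WithLp.ofLp x) : EuclideanSpace ℝ (Fin p)) t =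
        inner ℝ x (WithLp.toLp 2 (Jᵀ *ᵥ WithLp.ofLp t)) := fun x => by
    rw [EuclideanSpace.inner_eq_star_dotProduct, EuclideanSpace.inner_eq_star_dotProduct]
    simp only [star_trivial]
    rw [Matrix.dotProduct_mulVec, ← Matrix.mulVec_transpose]
  have hchar : ∀ N, charFun (μ.map fun ω => (WithLp.toLp 2 (J *ᵥ WithLp.ofLp (Z N ω)) :
      EuclideanSpace ℝ (Fin p))) t = charFun (μ.map (Z N)) (WithLp.toLp 2 (Jᵀ *ᵥ WithLp.ofLp t)) :=
    fun N => by
      rw [charFun_apply, charFun_apply, integral_map (hm N) (by fun_prop),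
        integral_map (hZ N) (by fun_prop)]
      simp only [hinner]
  simp only [hchar]
  convert h (WithLp.toLp 2 (Jᵀ *ᵥ WithLp.ofLp t)) using 3
  have hq : WithLp.ofLp t ⬝ᵥ Γ *ᵥ WithLp.ofLp t =
      σ ^ 2 * (Jᵀ *ᵥ WithLp.ofLp t ⬝ᵥ S *ᵥ (Jᵀ *ᵥ WithLp.ofLp t)) := by
    rw [hΓJ, Matrix.smul_mulVec, dotProduct_smul, smul_eq_mul, ← Matrix.mulVec_mulVec,
      ← Matrix.mulVec_mulVec, Matrix.dotProduct_mulVec, ← Matrix.mulVec_transpose]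
  rw [hq, inner_zero_right]
  push_cast
  ring

end InProbability

/-! ### Asymptotic normality -/

section Asymptotics

variable {n p : ℕ} {σ : ℝ} {θ₀ : Fin n → ℝ} {S : Matrix (Fin n) (Fin n) ℝ}
  {P : EuclideanSpace ℝ (Fin p) → Matrix (Fin n) (Fin n) ℝ} {Om : Set (EuclideanSpace ℝ (Fin p))}

lemma entryContDiffAt_inv_kernel (hOm : IsOpen Om)
    (hP_smooth : ∀ i j, ContDiffOn ℝ 2 (fun η => P η i j) Om)
    (hP_pos : ∀ η ∈ Om, (P η).PosDef) {η : EuclideanSpace ℝ (Fin p)} (hη : η ∈ Om) :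
    EntryContDiffAt 2 (fun η => (P η)⁻¹) η :=
  EntryContDiffAt.inv (fun i j => (hP_smooth i j).contDiffAt (hOm.mem_nhds hη))
    (hP_pos η hη).det_pos.ne'

lemma eventually_transpose_inv_kernel (hOm : IsOpen Om) (hP_pos : ∀ η ∈ Om, (P η).PosDef)
    {η : EuclideanSpace ℝ (Fin p)} (hη : η ∈ Om) :
    ∀ᶠ ξ in 𝓝 η, ((P ξ)⁻¹)ᵀ = (P ξ)⁻¹ := by
  filter_upwards [hOm.mem_nhds hη] with ξ hξ
  simpa using (hP_pos ξ hξ).inv.isHermitian.eq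

/-- The inverse Hessian `C_y⁻¹`, as a continuous linear map. -/
noncomputable def invHessian (σ : ℝ) (S : Matrix (Fin n) (Fin n) ℝ) (θ₀ : Fin n → ℝ)
    (P : EuclideanSpace ℝ (Fin p) → Matrix (Fin n) (Fin n) ℝ) (η : EuclideanSpace ℝ (Fin p)) :
    (Fin p → ℝ) →L[ℝ] EuclideanSpace ℝ (Fin p) :=
  ((EuclideanSpace.equiv (Fin p) ℝ).symm : (Fin p → ℝ) →L[ℝ] EuclideanSpace ℝ (Fin p)).comp
    (Matrix.toLin' (cMatrix σ S θ₀ P η)⁻¹).toContinuousLinearMap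

lemma invHessian_apply (η : EuclideanSpace ℝ (Fin p)) (y : Fin p → ℝ) :
    invHessian σ S θ₀ P η y = WithLp.toLp 2 ((cMatrix σ S θ₀ P η)⁻¹ *ᵥ y) := rfl

/-- The negative derivative, at the limit statistics, of the minimizer as a function of the
statistics. -/
noncomputable def negMinimizerDeriv (σ : ℝ) (S : Matrix (Fin n) (Fin n) ℝ) (θ₀ : Fin n → ℝ)
    (P : EuclideanSpace ℝ (Fin p) → Matrix (Fin n) (Fin n) ℝ) (η : EuclideanSpace ℝ (Fin p)) :
    Stat n →L[ℝ] EuclideanSpace ℝ (Fin p) :=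
  (invHessian σ S θ₀ P η).comp ((fderiv ℝ (reducedGrad σ θ₀ P) (η, limitStat S 0)).comp
    (ContinuousLinearMap.inr ℝ _ _))

/-- Minimizers of the reduced cost in `K`, for statistics close to their limit, are given to first
order by the derivative of the minimizer. -/
lemma eventually_minimizer_expansion (hOm : IsOpen Om)
    (hP_smooth : ∀ i j, ContDiffOn ℝ 2 (fun η => P η i j) Om)
    (hP_pos : ∀ η ∈ Om, (P η).PosDef) (hS : S.PosDef)
    {K : Set (EuclideanSpace ℝ (Fin p))} (hK : IsCompact K) (hKOm : K ⊆ Om)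
    {ηstar : EuclideanSpace ℝ (Fin p)}
    (hηstar : argminOn (fun η => limitCost σ S θ₀ (P η)) Om ∩ K = {ηstar})
    (hC : IsUnit (cMatrix σ S θ₀ P ηstar).det) {c : ℝ} (hc : 0 < c) :
    ∀ᶠ x in 𝓝 (limitStat S 0), ∀ η ∈ K,
      (∀ η' ∈ Om, reducedCostAt σ θ₀ P (η, x) ≤ reducedCostAt σ θ₀ P (η', x)) →
      ‖η - ηstar + negMinimizerDeriv σ S θ₀ P ηstar (x - limitStat S 0)‖ ≤
        c * ‖x - limitStat S 0‖ := by
  have hmem : ηstar ∈ argminOn (fun η => limitCost σ S θ₀ (P η)) Om ∩ K := by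
    rw [hηstar]; exact Set.mem_singleton _
  obtain ⟨⟨hsOm, hsmin⟩, hsK⟩ := hmem
  have hB : ∀ η ∈ Om, EntryContDiffAt 2 (fun η => (P η)⁻¹) η :=
    fun η hη => entryContDiffAt_inv_kernel hOm hP_smooth hP_pos hη
  have hsymm := eventually_transpose_inv_kernel hOm hP_pos hsOm
  have hlim : ∀ η, reducedCostAt σ θ₀ P (η, limitStat S 0) = limitCost σ S θ₀ (P η) := fun η => by
    rw [reducedCostAt_limitStat hS]; simp
  have hcd : ∀ η ∈ Om, ContDiffAt ℝ 2 (reducedCostAt σ θ₀ P) (η, limitStat S 0) :=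
    fun η hη => contDiffAt_reducedCostAt_limitStat hS (hB η hη) 0
  have hgd := differentiableAt_reducedGrad (hcd ηstar hsOm)
  have hg0 : reducedGrad σ θ₀ P (ηstar, limitStat S 0) = 0 := by
    refine reducedGrad_eq_zero ((hcd ηstar hsOm).differentiableAt two_ne_zero) ?_
    filter_upwards [hOm.mem_nhds hsOm] with η hη
    simpa only [hlim] using hsmin η hη
  have hexp := eventually_norm_le_of_hasFDerivAt hgd.hasFDerivAt hg0
    (invHessian σ S θ₀ P ηstar) (fun h => by
      rw [fderiv_reducedGrad_hyper hS (hB ηstar hsOm) hsymm, invHessian_apply,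
        Matrix.mulVec_mulVec, Matrix.nonsing_inv_mul _ hC, Matrix.one_mulVec]) hc
  have hdiff : ∀ᶠ ξ in 𝓝 (ηstar, limitStat S 0),
      DifferentiableAt ℝ (reducedCostAt σ θ₀ P) ξ := by
    filter_upwards [(hcd ηstar hsOm).eventually (by simp)] with ξ hξ
    exact hξ.differentiableAt two_ne_zero
  obtain ⟨U, hU, V, hV, hUV⟩ := mem_nhds_prod_iff.1 (hexp.and hdiff)
  have hcons := eventually_mem_nhds_of_le hK hsK
    (fun η hη => (hcd η (hKOm hη)).continuousAt) (fun η hη hne => by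
      rw [hlim, hlim]
      refine lt_of_le_of_ne (hsmin η (hKOm hη)) fun heq => hne ?_
      have : η ∈ argminOn (fun η => limitCost σ S θ₀ (P η)) Om ∩ K :=
        ⟨⟨hKOm hη, fun y hy => (show limitCost σ S θ₀ (P η) ≤ _ from heq ▸ hsmin y hy)⟩, hη⟩
      rw [hηstar] at this
      exact this) hU
  filter_upwards [hcons, hV] with x hx hxV η hηK hηmin
  obtain ⟨h1, h2⟩ := hUV (Set.mk_mem_prod (hx η hηK (hηmin ηstar hsOm)) hxV)
  refine h1 (reducedGrad_eq_zero h2 ?_)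
  filter_upwards [hOm.mem_nhds (hKOm hηK)] with η' hη'
  exact hηmin η' hη'

/-- The statistics `(z, R, e)` computed from `N` data points. -/
noncomputable def dataStat (σ : ℝ) (φ : ℕ → Fin n → ℝ) (v : ℕ → ℝ) (N : ℕ) : Stat n :=
  (noiseCorr φ v N, fun i j => empCov φ N i j, σ ^ 2 / N)

lemma reducedCostAt_le_of_mem_argminOn {φ : ℕ → Fin n → ℝ} {v : ℕ → ℝ} {N : ℕ} (hN : 0 < N)
    (hσ : 0 < σ) (hP_pos : ∀ η ∈ Om, (P η).PosDef) (hR : IsUnit (empCov φ N).det)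
    {η : EuclideanSpace ℝ (Fin p)}
    (hη : η ∈ argminOn (fun η => sureCost σ (regMatrix φ N) (outputVec θ₀ φ v N) (P η)) Om) :
    ∀ η' ∈ Om, reducedCostAt σ θ₀ P (η, dataStat σ φ v N) ≤
      reducedCostAt σ θ₀ P (η', dataStat σ φ v N) := by
  intro η' hη'
  obtain ⟨c, hc⟩ := sureCost_eq_reducedCost hN hσ (regMatrix φ N) θ₀ (fun t : Fin N => v t) hR
  have h : sureCost σ (regMatrix φ N) (regMatrix φ N *ᵥ θ₀ + fun t : Fin N => v t) (P η) ≤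
      sureCost σ (regMatrix φ N) (regMatrix φ N *ᵥ θ₀ + fun t : Fin N => v t) (P η') :=
    hη.2 η' hη'
  rw [hc _ (hP_pos η hη.1), hc _ (hP_pos η' hη')] at h
  have hN' : (0 : ℝ) < (N : ℝ)⁻¹ := by positivity
  exact le_of_mul_le_mul_left (le_of_add_le_add_left h) hN'

lemma norm_entries_le_frobNorm {m k : ℕ} (A : Matrix (Fin m) (Fin k) ℝ) :
    ‖(fun i j => A i j : Fin m → Fin k → ℝ)‖ ≤ frobNorm A := by
  refine (pi_norm_le_iff_of_nonneg (Real.sqrt_nonneg _)).2 fun i =>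
    (pi_norm_le_iff_of_nonneg (Real.sqrt_nonneg _)).2 fun j => ?_
  refine Real.abs_le_sqrt ?_
  calc A i j ^ 2 ≤ ∑ j, A i j ^ 2 :=
        Finset.single_le_sum (f := fun j => A i j ^ 2) (fun j _ => sq_nonneg _) (Finset.mem_univ j)
    _ ≤ ∑ i, ∑ j, A i j ^ 2 :=
        Finset.single_le_sum (f := fun i => ∑ j, A i j ^ 2)
          (fun i _ => Finset.sum_nonneg fun j _ => sq_nonneg _) (Finset.mem_univ i)

lemma dMatrix_eq (hS : (S⁻¹)ᵀ = S⁻¹) {η : EuclideanSpace ℝ (Fin p)}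
    (hsymm : ∀ᶠ ξ in 𝓝 η, ((P ξ)⁻¹)ᵀ = (P ξ)⁻¹) :
    dMatrix σ S θ₀ P η =
      (4 * σ ^ 10) • (dInvSqRows S θ₀ P η * S⁻¹ * (dInvSqRows S θ₀ P η)ᵀ) := by
  ext k l
  rw [Matrix.mul_assoc (dInvSqRows S θ₀ P η)]
  change 4 * σ ^ 10 * (θ₀ ⬝ᵥ (dInvSq S P k η * S⁻¹ * dInvSq S P l η) *ᵥ θ₀) =
    4 * σ ^ 10 * (dInvSq S P k η *ᵥ θ₀ ⬝ᵥ S⁻¹ *ᵥ (dInvSq S P l η *ᵥ θ₀))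
  rw [← Matrix.mulVec_mulVec, ← Matrix.mulVec_mulVec, Matrix.dotProduct_mulVec,
    ← Matrix.mulVec_transpose, transpose_dInvSq hS hsymm k]

/-- The matrix through which the noise correlation enters the expansion of the minimizer. -/
noncomputable def noiseSensitivity (σ : ℝ) (S : Matrix (Fin n) (Fin n) ℝ) (θ₀ : Fin n → ℝ)
    (P : EuclideanSpace ℝ (Fin p) → Matrix (Fin n) (Fin n) ℝ) (η : EuclideanSpace ℝ (Fin p)) :
    Matrix (Fin p) (Fin n) ℝ :=
  -(2 * σ ^ 4) • ((cMatrix σ S θ₀ P η)⁻¹ * (dInvSqRows S θ₀ P η * S⁻¹))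

lemma negMinimizerDeriv_noise (hS : S.PosDef) {η : EuclideanSpace ℝ (Fin p)}
    (hB : EntryContDiffAt 2 (fun η => (P η)⁻¹) η)
    (hsymm : ∀ᶠ ξ in 𝓝 η, ((P ξ)⁻¹)ᵀ = (P ξ)⁻¹) (w : EuclideanSpace ℝ (Fin n)) :
    negMinimizerDeriv σ S θ₀ P η (w, 0) =
      -WithLp.toLp 2 (noiseSensitivity σ S θ₀ P η *ᵥ WithLp.ofLp w) := by
  change invHessian σ S θ₀ P η
    (fderiv ℝ (reducedGrad σ θ₀ P) (η, limitStat S 0) (0, w, 0)) = _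
  rw [fderiv_reducedGrad_noise hS hB hsymm, invHessian_apply, noiseSensitivity,
    Matrix.smul_mulVec, Matrix.mulVec_smul, Matrix.mulVec_mulVec, neg_smul, WithLp.toLp_neg,
    neg_neg]

/-- The asymptotic covariance `C_y⁻¹ D_y C_y⁻¹` is the covariance of the linear image of the
limit law `N(0, σ² Σ)` of the scaled noise correlation. -/
lemma sandwich_eq (hS : S.PosDef) {η : EuclideanSpace ℝ (Fin p)}
    (hB : EntryContDiffAt 2 (fun η => (P η)⁻¹) η)
    (hsymm : ∀ᶠ ξ in 𝓝 η, ((P ξ)⁻¹)ᵀ = (P ξ)⁻¹) :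
    (cMatrix σ S θ₀ P η)⁻¹ * dMatrix σ S θ₀ P η * (cMatrix σ S θ₀ P η)⁻¹ =
      σ ^ 2 • (noiseSensitivity σ S θ₀ P η * S * (noiseSensitivity σ S θ₀ P η)ᵀ) := by
  have hSt : (S⁻¹)ᵀ = S⁻¹ := by simpa using hS.inv.isHermitian.eq
  have hCt : ((cMatrix σ S θ₀ P η)⁻¹)ᵀ = (cMatrix σ S θ₀ P η)⁻¹ := by
    rw [Matrix.transpose_nonsing_inv, cMatrix_isSymm θ₀ hSt hB hsymm]
  rw [dMatrix_eq hSt hsymm, noiseSensitivity, Matrix.transpose_smul, Matrix.transpose_mul,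
    Matrix.transpose_mul, hCt, hSt]
  simp only [Matrix.smul_mul, Matrix.mul_smul, smul_smul, Matrix.mul_assoc]
  rw [Matrix.mul_nonsing_inv_cancel_left _ _ (isUnit_det_of_posDef hS)]
  congr 1
  ring

lemma posSemidef_sandwich (hS : S.PosDef) {η : EuclideanSpace ℝ (Fin p)}
    (hB : EntryContDiffAt 2 (fun η => (P η)⁻¹) η)
    (hsymm : ∀ᶠ ξ in 𝓝 η, ((P ξ)⁻¹)ᵀ = (P ξ)⁻¹) :
    ((cMatrix σ S θ₀ P η)⁻¹ * dMatrix σ S θ₀ P η * (cMatrix σ S θ₀ P η)⁻¹).PosSemidef := by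
  rw [sandwich_eq hS hB hsymm]
  have h := hS.posSemidef.mul_mul_conjTranspose_same (noiseSensitivity σ S θ₀ P η)
  rw [Matrix.conjTranspose_eq_transpose_of_trivial] at h
  exact h.smul (sq_nonneg σ)

section Data

variable {α : Type*} [MeasurableSpace α] {μ : Measure α}

/-- The part of the statistics other than the noise correlation is negligible at scale `1 / √N`. -/
lemma tendsto_measure_sqrt_mul_remainder {R : ℕ → α → Matrix (Fin n) (Fin n) ℝ} {δ : ℕ → ℝ}
    (hrate : BoundedInProb μ (fun N ω => frobNorm (R N ω - S)) δ)
    (hδ : δ =o[atTop] fun N : ℕ => 1 / Real.sqrt N) {a : ℝ} (ha : 0 < a) :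
    Tendsto (fun N : ℕ => μ {ω | a ≤ Real.sqrt N *
      ‖((0, (fun i j => (R N ω - S) i j), σ ^ 2 / N) : Stat n)‖}) atTop (𝓝 0) := by
  have hsqrt : Tendsto (fun N : ℕ => Real.sqrt N) atTop atTop :=
    Real.tendsto_sqrt_atTop.comp tendsto_natCast_atTop_atTop
  refine ENNReal.tendsto_nhds_zero.2 fun ε hε => ?_
  obtain ⟨ε', hε'0, hε'⟩ : ∃ ε' : ℝ, 0 < ε' ∧ ENNReal.ofReal ε' ≤ ε := by
    rcases eq_or_ne ε ⊤ with rfl | htop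
    · exact ⟨1, one_pos, le_top⟩
    · exact ⟨ε.toReal, ENNReal.toReal_pos hε.ne' htop, by rw [ENNReal.ofReal_toReal htop]⟩
  obtain ⟨L, hL, hLN⟩ := hrate ε' hε'0
  have hlo := hδ.def (c := a / (2 * L)) (by positivity)
  filter_upwards [hlo, hsqrt.eventually_gt_atTop (σ ^ 2 / a), hsqrt.eventually_gt_atTop 0,
    eventually_ge_atTop 1] with N h1 h2 h3 h4
  refine (measure_mono fun ω hω => ?_).trans ((hLN N h4).le.trans hε')
  simp only [Set.mem_ofPred_eq] at hω ⊢
  have hN : (N : ℝ) = Real.sqrt N * Real.sqrt N := (Real.mul_self_sqrt (Nat.cast_nonneg N)).symm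
  -- The component `σ² / N` is too small to account for the norm
  have hsmall : Real.sqrt N * (σ ^ 2 / N) < a := by
    have : Real.sqrt N * (σ ^ 2 / N) = σ ^ 2 / Real.sqrt N := by
      nth_rewrite 2 [hN]; field_simp
    rw [this, div_lt_iff₀ h3]
    rwa [div_lt_iff₀ ha, mul_comm] at h2
  have hnorm : ‖((0, (fun i j => (R N ω - S) i j), σ ^ 2 / N) : Stat n)‖ ≤
      max (frobNorm (R N ω - S)) (σ ^ 2 / N) := by
    rw [Prod.norm_def, Prod.norm_def]
    simp only [norm_zero]
    refine max_le (le_max_of_le_right (by positivity)) (max_le_max (norm_entries_le_frobNorm _) ?_)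
    rw [Real.norm_of_nonneg (by positivity)]
  have hfrob : a ≤ Real.sqrt N * frobNorm (R N ω - S) := by
    have h5 := hω.trans (mul_le_mul_of_nonneg_left hnorm h3.le)
    rw [mul_max_of_nonneg _ _ h3.le] at h5
    exact (le_max_iff.1 h5).resolve_right (not_le.2 hsmall)
  rw [Real.norm_eq_abs, Real.norm_of_nonneg (by positivity)] at h1
  have h6 : L * |δ N| ≤ a / 2 / Real.sqrt N := by
    calc L * |δ N| ≤ L * (a / (2 * L) * (1 / Real.sqrt N)) := by gcongr
      _ = a / 2 / Real.sqrt N := by field_simp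
  have h7 : a / 2 / Real.sqrt N < frobNorm (R N ω - S) := by
    rw [div_lt_iff₀ h3, mul_comm]; linarith
  exact lt_of_lt_of_le (h6.trans_lt h7) (le_abs_self _)

end Data

end Asymptotics

theorem theorem4
    {α : Type*} [MeasurableSpace α] (μ : Measure α) [IsProbabilityMeasure μ]
    {n p : ℕ}
    -- true parameter and noise level
    (θ₀ : Fin n → ℝ) (σ : ℝ) (hσ : 0 < σ)
    -- regressors and i.i.d. Gaussian noise, independent of the regressors
    (φ : ℕ → α → Fin n → ℝ) (v : ℕ → α → ℝ)
    (hφ : ∀ t, Measurable (φ t))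
    (hv : ∀ t, HasLaw (v t) (gaussianReal 0 (σ ^ 2).toNNReal) μ)
    (hv_indep : iIndepFun v μ)
    (hφv : IndepFun (fun ω t => φ t ω) (fun ω t => v t ω) μ)
    -- the open set of hyper-parameters and the kernel matrix
    (Om : Set (EuclideanSpace ℝ (Fin p))) (hOm : IsOpen Om)
    (P : EuclideanSpace ℝ (Fin p) → Matrix (Fin n) (Fin n) ℝ)
    (hP_smooth : ∀ i j, ContDiffOn ℝ 2 (fun η => P η i j) Om)
    (hP_pos : ∀ η ∈ Om, (P η).PosDef)
    -- almost sure convergence of `ΦᵀΦ / N` to `S`, with rate `δ N = o(1 / √N)` in probability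
    (S : Matrix (Fin n) (Fin n) ℝ) (hS : S.PosDef)
    (hconv : ∀ᵐ ω ∂μ, Tendsto
      (fun N : ℕ => (N : ℝ)⁻¹ •
        ((regMatrix (fun t => φ t ω) N)ᵀ * regMatrix (fun t => φ t ω) N))
      atTop (𝓝 S))
    (δ : ℕ → ℝ)
    (hrate : BoundedInProb μ
      (fun (N : ℕ) ω => frobNorm ((N : ℝ)⁻¹ •
        ((regMatrix (fun t => φ t ω) N)ᵀ * regMatrix (fun t => φ t ω) N) - S)) δ)
    (hδ : δ =o[atTop] fun N : ℕ => 1 / Real.sqrt N)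
    -- the limit `ηstar`: the only minimizer of the limit cost over `Om` that lies in `K`
    (K : Set (EuclideanSpace ℝ (Fin p))) (hK : IsCompact K) (hKOm : K ⊆ Om)
    (ηstar : EuclideanSpace ℝ (Fin p))
    (hηstar : argminOn (fun η => limitCost σ S θ₀ (P η)) Om ∩ K = {ηstar})
    (hC : IsUnit (cMatrix σ S θ₀ P ηstar).det)
    -- the estimator: with probability tending to one, a minimizer of the `SURE_y` cost over `Om`
    -- that lies in `K`
    (ηhat : ℕ → α → EuclideanSpace ℝ (Fin p)) (hηhat : ∀ N, Measurable (ηhat N))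
    (hmin : Tendsto
      (fun N : ℕ => μ {ω | ¬ (ηhat N ω ∈ argminOn
        (fun η => sureCost σ (regMatrix (fun t => φ t ω) N)
          (outputVec θ₀ (fun t => φ t ω) (fun t => v t ω) N) (P η)) Om ∩ K)})
      atTop (𝓝 0)) :
    -- `C_y` is the Hessian of the limit cost at `ηstar`
    (∀ k l, cMatrix σ S θ₀ P ηstar k l =
      partialDeriv k (partialDeriv l fun η => limitCost σ S θ₀ (P η)) ηstar) ∧
    -- `C_y⁻¹ D_y C_y⁻¹` is a covariance matrix
    ((cMatrix σ S θ₀ P ηstar)⁻¹ * dMatrix σ S θ₀ P ηstar *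
      (cMatrix σ S θ₀ P ηstar)⁻¹).PosSemidef ∧
    -- `√N (ηhat_N - ηstar)` converges in distribution to `N(0, C_y⁻¹ D_y C_y⁻¹)`
    TendstoInDistribution (fun (N : ℕ) ω => Real.sqrt N • (ηhat N ω - ηstar)) atTop
      (id : EuclideanSpace ℝ (Fin p) → EuclideanSpace ℝ (Fin p)) (fun _ => μ)
      (multivariateGaussian 0 ((cMatrix σ S θ₀ P ηstar)⁻¹ * dMatrix σ S θ₀ P ηstar *
        (cMatrix σ S θ₀ P ηstar)⁻¹)) := by
  have hstar : ηstar ∈ argminOn (fun η => limitCost σ S θ₀ (P η)) Om ∩ K := by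
    rw [hηstar]; exact Set.mem_singleton _
  have hsOm : ηstar ∈ Om := hstar.1.1
  have hB := entryContDiffAt_inv_kernel hOm hP_smooth hP_pos hsOm
  have hsymm := eventually_transpose_inv_kernel hOm hP_pos hsOm
  have hSt : (S⁻¹)ᵀ = S⁻¹ := by simpa using hS.inv.isHermitian.eq
  have hpsd := posSemidef_sandwich (σ := σ) (θ₀ := θ₀) hS hB hsymm
  refine ⟨cMatrix_eq_partialDeriv θ₀ hSt hB hsymm, hpsd, ?_⟩
  have hvm : ∀ t, AEMeasurable (v t) μ := fun t => (hv t).aemeasurable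
  have hsqrt : Tendsto (fun N : ℕ => Real.sqrt N) atTop atTop :=
    Real.tendsto_sqrt_atTop.comp tendsto_natCast_atTop_atTop
  -- the scaled noise correlation and its limit law
  set Z : ℕ → α → EuclideanSpace ℝ (Fin n) :=
    fun N ω => Real.sqrt N • noiseCorr (fun t => φ t ω) (fun t => v t ω) N with hZdef
  have hZm : ∀ N, AEMeasurable (Z N) μ := fun N =>
    (aemeasurable_noiseCorr hφ hvm N).const_smul (Real.sqrt N)
  have hZchar := tendsto_charFun_sqrt_smul_noiseCorr hφ hv hv_indep hφv hconv
  have hlaw := tendstoInDistribution_mulVec_gaussian hZm hZchar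
    (noiseSensitivity σ S θ₀ P ηstar) hpsd (sandwich_eq hS hB hsymm)
  -- deviations of the statistics from their limit, and the part not due to the noise correlation
  set y : ℕ → α → Stat n := fun N ω =>
    dataStat σ (fun t => φ t ω) (fun t => v t ω) N - limitStat S 0 with hydef
  set q : ℕ → α → Stat n := fun N ω =>
    (0, (fun i j => (empCov (fun t => φ t ω) N - S) i j), σ ^ 2 / N) with hqdef
  have hyq : ∀ N ω, y N ω - q N ω =
      (noiseCorr (fun t => φ t ω) (fun t => v t ω) N, 0) := fun N ω => by
    refine Prod.ext ?_ (Prod.ext ?_ ?_)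
    · simp [hydef, hqdef, dataStat, limitStat]
    · funext i j; simp [hydef, hqdef, dataStat, limitStat]
    · simp [hydef, hqdef, dataStat, limitStat]
  have hq : ∀ a : ℝ, 0 < a →
      Tendsto (fun N : ℕ => μ {ω | a ≤ Real.sqrt N * ‖q N ω‖}) atTop (𝓝 0) :=
    fun a ha => tendsto_measure_sqrt_mul_remainder hrate hδ ha
  have hybdd : ∀ ε : ENNReal, 0 < ε →
      ∃ L : ℝ, ∀ᶠ N : ℕ in atTop, μ {ω | L < Real.sqrt N * ‖y N ω‖} ≤ ε := by
    intro ε hε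
    have hε2 : 0 < ε / 2 := ENNReal.half_pos hε.ne'
    obtain ⟨L, hL⟩ := exists_forall_measure_norm_gt_le hZm
      (Continuous.continuousAt (by fun_prop)) hZchar hε2
    refine ⟨L + 1, ?_⟩
    filter_upwards [ENNReal.tendsto_nhds_zero.1 (hq 1 one_pos) _ hε2] with N hN
    refine (measure_mono (t := {ω | L < ‖Z N ω‖} ∪ {ω | 1 ≤ Real.sqrt N * ‖q N ω‖})
      fun ω hω => ?_).trans ((measure_union_le _ _).trans
        ((add_le_add (hL N) hN).trans (ENNReal.add_halves ε).le))
    by_contra hcon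
    simp only [Set.mem_union, Set.mem_ofPred_eq, not_or, not_lt, not_le] at hcon hω
    have h1 : ‖y N ω‖ ≤ ‖noiseCorr (fun t => φ t ω) (fun t => v t ω) N‖ + ‖q N ω‖ := by
      have h2 : y N ω = (noiseCorr (fun t => φ t ω) (fun t => v t ω) N, 0) + q N ω := by
        rw [← hyq, sub_add_cancel]
      rw [h2]
      refine (norm_add_le _ _).trans (add_le_add_left ?_ _)
      rw [Prod.norm_def]; simp
    have h3 : ‖Z N ω‖ = Real.sqrt N * ‖noiseCorr (fun t => φ t ω) (fun t => v t ω) N‖ := by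
      rw [hZdef, norm_smul, Real.norm_of_nonneg (Real.sqrt_nonneg _)]
    have h4 := mul_le_mul_of_nonneg_left h1 (Real.sqrt_nonneg (N : ℝ))
    rw [mul_add, ← h3] at h4
    linarith [hcon.1, hcon.2]
  -- the first-order expansion holds with probability tending to one
  have hdet : ∀ᶠ x in 𝓝 (limitStat S 0), IsUnit (Matrix.of x.2.1).det := by
    have hcont : Continuous fun x : Stat n => (Matrix.of x.2.1).det :=
      Continuous.matrix_det (continuous_fst.comp continuous_snd)
    filter_upwards [hcont.continuousAt.eventually_ne hS.det_pos.ne'] with x hx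
    exact hx.isUnit
  have hexp : ∀ c : ℝ, 0 < c → Tendsto (fun N => μ {ω | ¬ ‖(ηhat N ω - ηstar) +
      negMinimizerDeriv σ S θ₀ P ηstar (y N ω)‖ ≤ c * ‖y N ω‖}) atTop (𝓝 0) := by
    intro c hc
    have hev := (eventually_minimizer_expansion hOm hP_smooth hP_pos hS hK hKOm hηstar hC hc).and
      hdet
    have hU : {d : Stat n | (∀ η ∈ K,
        (∀ η' ∈ Om, reducedCostAt σ θ₀ P (η, limitStat S 0 + d) ≤
          reducedCostAt σ θ₀ P (η', limitStat S 0 + d)) →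
        ‖η - ηstar + negMinimizerDeriv σ S θ₀ P ηstar (limitStat S 0 + d - limitStat S 0)‖ ≤
          c * ‖limitStat S 0 + d - limitStat S 0‖) ∧
        IsUnit (Matrix.of (limitStat S 0 + d).2.1).det} ∈ 𝓝 (0 : Stat n) :=
      (Continuous.tendsto' (continuous_const.add continuous_id) 0 (limitStat S 0)
        (by simp)).eventually hev
    have hfar := tendsto_measure_compl_of_bounded hsqrt hybdd hU
    have hsum := hmin.add hfar
    rw [add_zero] at hsum
    refine tendsto_of_tendsto_of_tendsto_of_le_of_le' tendsto_const_nhds hsum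
      (Eventually.of_forall fun _ => zero_le) ?_
    filter_upwards [eventually_gt_atTop 0] with N hN
    refine (measure_mono fun ω hω => ?_).trans (measure_union_le _ _)
    by_contra hcon
    simp only [Set.mem_union, Set.mem_ofPred_eq, not_or, not_not] at hcon
    obtain ⟨hgood, hnear⟩ := hcon
    have hxy : limitStat S 0 + y N ω = dataStat σ (fun t => φ t ω) (fun t => v t ω) N := by
      rw [hydef]; simp
    rw [hxy] at hnear
    exact hω (hnear.1 _ hgood.2 (reducedCostAt_le_of_mem_argminOn hN hσ hP_pos hnear.2 hgood.1))
  have hmeas := tendstoInMeasure_of_expansion (fun N => Real.sqrt_nonneg (N : ℝ))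
    (negMinimizerDeriv σ S θ₀ P ηstar) hexp hybdd hq
  refine tendstoInDistribution_of_tendstoInMeasure_sub _ _ hlaw ?_
    (fun N => (((hηhat N).sub_const ηstar).const_smul (Real.sqrt N)).aemeasurable)
  convert hmeas using 1
  funext N ω
  rw [hyq, negMinimizerDeriv_noise hS hB hsymm]
  simp only [Pi.sub_apply, hZdef, WithLp.ofLp_smul, Matrix.mulVec_smul, WithLp.toLp_smul,
    smul_add, smul_neg, sub_eq_add_neg]
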